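/- Let $d\in\{1,2\}$, $r\in(0,1)$, and let $c\in C(\mathbb R^d)$ be of the form $c(x)=c_0+c_1(x)$ with a constant $c_0>0$ and a real-valued function $0\le c_1\in H^{r+1}(\mathbb R^d)$. For every $v\in H^2(\mathbb R^d)$ the distribution $Av=\operatorname{div}(c(x)\operatorname{grad}v)$ belongs to $L^2(\mathbb R^d)$, and the operator $A$ with domain $D(A)=H^2(\mathbb R^d)$ is self-adjoint in the complex Hilbert space $L^2(\mathbb R^d)$. The operator $iA$ generates a strongly continuous unitary group $(T(z))_{z\in\mathbb R}$ on $L^2(\mathbb R^d)$. Moreover, for every $\lambda\in\mathbb R\setminus\{0\}$ the operator $iA-\lambda\colon H^2(\mathbb R^d)\to L^2(\mathbb R^d)$ has a bounded inverse defined on all of $L^2(\mathbb R^d)$, and $$\|(iA-\lambda)^{-1}v\|_{L^2}\le\frac{\|v\|_{L^2}}{|\lambda|}\qquad\text{for all } v\in L^2(\mathbb R^d).$$ -/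

import Mathlib

open MeasureTheory Filter Topology
open scoped SchwartzMap LineDeriv ContDiff ENNReal

noncomputable section

/-- The Hilbert space `L²(ℝᵈ)` of complex-valued functions. -/
abbrev L2Space (d : ℕ) : Type :=
  Lp ℂ 2 (volume : Measure (EuclideanSpace ℝ (Fin d)))

/-- The Sobolev space `Hˢ(ℝᵈ)`, `s ≥ 0`, as a linear subspace of `L²(ℝᵈ)`: those `v ∈ L²` for
which `(1 + |ξ|²)^(s/2) v̂` is in `L²`. -/
def sobolevSpace (d : ℕ) (s : ℝ) : Submodule ℂ (L2Space d) where
  carrier := {v | TemperedDistribution.MemSobolev s 2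
    (v : 𝓢'(EuclideanSpace ℝ (Fin d), ℂ))}
  add_mem' {u v} hu hv := by
    have h := TemperedDistribution.MemSobolev.add hu hv
    simp only [← Lp.toTemperedDistributionCLM_apply] at h
    simpa only [Set.mem_ofPred_eq, ← Lp.toTemperedDistributionCLM_apply, map_add] using h
  zero_mem' := by
    simp only [Set.mem_ofPred_eq, ← Lp.toTemperedDistributionCLM_apply, map_zero]
    exact TemperedDistribution.memSobolev_fun_zero _ _ s 2
  smul_mem' a v hv := by
    have h := TemperedDistribution.MemSobolev.smul a hv
    simp only [← Lp.toTemperedDistributionCLM_apply] at h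
    simpa only [Set.mem_ofPred_eq, ← Lp.toTemperedDistributionCLM_apply, map_smul] using h

/-- A real-valued function on `ℝᵈ` belongs to `Hˢ(ℝᵈ)`, `s ≥ 0`. -/
def MemHs {d : ℕ} (s : ℝ) (f : EuclideanSpace ℝ (Fin d) → ℝ) : Prop :=
  ∃ hf : MemLp (fun x => (f x : ℂ)) 2 volume, hf.toLp (fun x => (f x : ℂ)) ∈ sobolevSpace d s

/-- `g = (g₁, …, g_d) ∈ (L²)ᵈ` is the distributional gradient of `v ∈ L²(ℝᵈ)`. -/
def IsWeakGrad {d : ℕ} (v : L2Space d) (g : Fin d → L2Space d) : Prop :=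
  ∀ j, ((g j : L2Space d) : 𝓢'(EuclideanSpace ℝ (Fin d), ℂ)) =
    ∂_{(EuclideanSpace.single j (1 : ℝ) : EuclideanSpace ℝ (Fin d))}
      (v : 𝓢'(EuclideanSpace ℝ (Fin d), ℂ))

/-- `div (c g) = w` in the sense of distributions on `ℝᵈ`, for continuous real `c`,
`g ∈ (L²)ᵈ` and `w ∈ L²`: for all test functions `φ ∈ C_c^∞(ℝᵈ)`,
`∑ⱼ ∫ c gⱼ ∂ⱼφ = - ∫ w φ`. -/
def IsWeakDiv {d : ℕ} (c : C(EuclideanSpace ℝ (Fin d), ℝ)) (g : Fin d → L2Space d)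
    (w : L2Space d) : Prop :=
  ∀ φ : EuclideanSpace ℝ (Fin d) → ℂ, ContDiff ℝ ∞ φ → HasCompactSupport φ →
    ∑ j, ∫ x, (c x : ℂ) * g j x * fderiv ℝ φ x (EuclideanSpace.single j 1) =
      - ∫ x, w x * φ x

/-- `v ∈ H²(ℝᵈ)`, and `div (c grad v)`, computed in the sense of distributions, is `w ∈ L²(ℝᵈ)`. -/
def IsDivGrad {d : ℕ} (c : C(EuclideanSpace ℝ (Fin d), ℝ)) (v w : L2Space d) : Prop :=
  v ∈ sobolevSpace d 2 ∧ ∃ g : Fin d → L2Space d, IsWeakGrad v g ∧ IsWeakDiv c g w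

section Helpers

variable {d : ℕ}

theorem L2Space.integrable_mul (u : L2Space d) {ψ : EuclideanSpace ℝ (Fin d) → ℂ}
    (hψ : Continuous ψ) (hs : HasCompactSupport ψ) : Integrable (fun x => u x * ψ x) volume :=
  (Lp.memLp u).integrable_mul (p := 2) (q := 2) (hψ.memLp_of_hasCompactSupport hs)

theorem IsWeakDiv.integrable (c : C(EuclideanSpace ℝ (Fin d), ℝ)) (u : L2Space d)
    {φ : EuclideanSpace ℝ (Fin d) → ℂ} (hφ : ContDiff ℝ ∞ φ) (hs : HasCompactSupport φ)
    (e : EuclideanSpace ℝ (Fin d)) :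
    Integrable (fun x => (c x : ℂ) * u x * fderiv ℝ φ x e) volume := by
  have h1 : Continuous (fun x => fderiv ℝ φ x e) :=
    (hφ.continuous_fderiv (by simp)).clm_apply continuous_const
  have h2 : HasCompactSupport (fun x => fderiv ℝ φ x e) := hs.fderiv_apply ℝ e
  have h3 : Continuous (fun x => (c x : ℂ) * fderiv ℝ φ x e) :=
    (Complex.continuous_ofReal.comp c.continuous).mul h1
  refine (u.integrable_mul h3 h2.mul_left).congr (Eventually.of_forall fun x => ?_)
  ring

theorem IsWeakDiv.add {c : C(EuclideanSpace ℝ (Fin d), ℝ)} {g g' : Fin d → L2Space d}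
    {w w' : L2Space d} (h : IsWeakDiv c g w) (h' : IsWeakDiv c g' w') :
    IsWeakDiv c (g + g') (w + w') := by
  intro φ hφ hs
  have e1 : ∀ j, ∫ x, (c x : ℂ) * (g + g') j x * fderiv ℝ φ x (EuclideanSpace.single j 1) =
      (∫ x, (c x : ℂ) * g j x * fderiv ℝ φ x (EuclideanSpace.single j 1)) +
        ∫ x, (c x : ℂ) * g' j x * fderiv ℝ φ x (EuclideanSpace.single j 1) := fun j => by
    rw [← integral_add (IsWeakDiv.integrable c _ hφ hs _) (IsWeakDiv.integrable c _ hφ hs _)]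
    refine integral_congr_ae ?_
    filter_upwards [Lp.coeFn_add (g j) (g' j)] with x hx
    simp only [Pi.add_apply] at hx ⊢
    rw [hx]; ring
  have e2 : ∫ x, (w + w') x * φ x = (∫ x, w x * φ x) + ∫ x, w' x * φ x := by
    rw [← integral_add (w.integrable_mul hφ.continuous hs) (w'.integrable_mul hφ.continuous hs)]
    refine integral_congr_ae ?_
    filter_upwards [Lp.coeFn_add w w'] with x hx
    rw [hx, Pi.add_apply]; ring
  simp only [e1, e2, Finset.sum_add_distrib, h φ hφ hs, h' φ hφ hs]
  ring

theorem IsWeakDiv.smul {c : C(EuclideanSpace ℝ (Fin d), ℝ)} {g : Fin d → L2Space d}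
    {w : L2Space d} (a : ℂ) (h : IsWeakDiv c g w) : IsWeakDiv c (a • g) (a • w) := by
  intro φ hφ hs
  have e1 : ∀ j, ∫ x, (c x : ℂ) * (a • g) j x * fderiv ℝ φ x (EuclideanSpace.single j 1) =
      a * ∫ x, (c x : ℂ) * g j x * fderiv ℝ φ x (EuclideanSpace.single j 1) := fun j => by
    rw [← integral_const_mul]
    refine integral_congr_ae ?_
    filter_upwards [Lp.coeFn_smul a (g j)] with x hx
    simp only [Pi.smul_apply, smul_eq_mul] at hx ⊢
    rw [hx]; ring
  have e2 : ∫ x, (a • w) x * φ x = a * ∫ x, w x * φ x := by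
    rw [← integral_const_mul]
    refine integral_congr_ae ?_
    filter_upwards [Lp.coeFn_smul a w] with x hx
    rw [hx, Pi.smul_apply, smul_eq_mul]; ring
  simp only [e1, e2, ← Finset.mul_sum, h φ hφ hs]
  ring

theorem IsWeakDiv.unique {c : C(EuclideanSpace ℝ (Fin d), ℝ)} {g : Fin d → L2Space d}
    {w w' : L2Space d} (h : IsWeakDiv c g w) (h' : IsWeakDiv c g w') : w = w' := by
  have hloc : ∀ u : L2Space d, LocallyIntegrable u volume := fun u =>
    (Lp.memLp u).locallyIntegrable (by norm_num)
  refine Lp.ext ?_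
  refine ae_eq_of_integral_contDiff_smul_eq (hloc w) (hloc w') fun ψ hψ hs => ?_
  have hφ : ContDiff ℝ ∞ (fun x => (ψ x : ℂ)) := Complex.ofRealCLM.contDiff.comp hψ
  have hsφ : HasCompactSupport (fun x => (ψ x : ℂ)) :=
    hs.comp_left (g := fun t : ℝ => (t : ℂ)) Complex.ofReal_zero
  have e := neg_injective ((h _ hφ hsφ).symm.trans (h' _ hφ hsφ))
  simpa only [Complex.real_smul, mul_comm] using e

theorem IsWeakGrad.unique {v : L2Space d} {g g' : Fin d → L2Space d}
    (h : IsWeakGrad v g) (h' : IsWeakGrad v g') : g = g' := by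
  funext j
  have hinj : Function.Injective
      (Lp.toTemperedDistributionCLM ℂ (volume : Measure (EuclideanSpace ℝ (Fin d))) 2) :=
    LinearMap.ker_eq_bot.mp Lp.ker_toTemperedDistributionCLM_eq_bot
  apply hinj
  simp only [Lp.toTemperedDistributionCLM_apply]
  exact (h j).trans (h' j).symm

theorem IsWeakGrad.add {v v' : L2Space d} {g g' : Fin d → L2Space d}
    (h : IsWeakGrad v g) (h' : IsWeakGrad v' g') : IsWeakGrad (v + v') (g + g') := by
  intro j
  have h1 := h j
  have h2 := h' j
  simp only [← Lp.toTemperedDistributionCLM_apply] at h1 h2 ⊢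
  rw [Pi.add_apply, map_add, map_add, LineDeriv.lineDerivOp_add, h1, h2]

theorem IsWeakGrad.smul {v : L2Space d} {g : Fin d → L2Space d} (a : ℂ)
    (h : IsWeakGrad v g) : IsWeakGrad (a • v) (a • g) := by
  intro j
  have h1 := h j
  simp only [← Lp.toTemperedDistributionCLM_apply] at h1 ⊢
  rw [Pi.smul_apply, map_smul, map_smul, LineDeriv.lineDerivOp_smul, h1]

theorem IsDivGrad.unique {c : C(EuclideanSpace ℝ (Fin d), ℝ)} {v w w' : L2Space d}
    (h : IsDivGrad c v w) (h' : IsDivGrad c v w') : w = w' := by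
  obtain ⟨-, g, hg, hw⟩ := h
  obtain ⟨-, g', hg', hw'⟩ := h'
  obtain rfl := hg.unique hg'
  exact hw.unique hw'

theorem IsDivGrad.add {c : C(EuclideanSpace ℝ (Fin d), ℝ)} {v w v' w' : L2Space d}
    (h : IsDivGrad c v w) (h' : IsDivGrad c v' w') : IsDivGrad c (v + v') (w + w') := by
  obtain ⟨hv, g, hg, hw⟩ := h
  obtain ⟨hv', g', hg', hw'⟩ := h'
  exact ⟨add_mem hv hv', g + g', hg.add hg', hw.add hw'⟩

theorem IsDivGrad.smul {c : C(EuclideanSpace ℝ (Fin d), ℝ)} {v w : L2Space d} (a : ℂ)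
    (h : IsDivGrad c v w) : IsDivGrad c (a • v) (a • w) := by
  obtain ⟨hv, g, hg, hw⟩ := h
  exact ⟨Submodule.smul_mem _ a hv, a • g, hg.smul a, hw.smul a⟩

theorem IsDivGrad.zero (c : C(EuclideanSpace ℝ (Fin d), ℝ)) : IsDivGrad c 0 0 := by
  refine ⟨zero_mem _, 0, fun j => ?_, fun φ hφ hs => ?_⟩
  · simp only [← Lp.toTemperedDistributionCLM_apply, Pi.zero_apply, map_zero]
    exact (map_zero (LineDeriv.lineDerivOpCLM ℂ 𝓢'(EuclideanSpace ℝ (Fin d), ℂ)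
      (EuclideanSpace.single j (1 : ℝ) : EuclideanSpace ℝ (Fin d)))).symm
  · have h0 : ∀ᵐ x, (0 : L2Space d) x = 0 := Lp.coeFn_zero ℂ 2 volume
    have h1 : ∫ x, (0 : L2Space d) x * φ x = 0 := by
      refine integral_eq_zero_of_ae ?_
      filter_upwards [h0] with x hx
      rw [hx, zero_mul, Pi.zero_apply]
    have h2 : ∀ j : Fin d, ∫ x, (c x : ℂ) * (0 : Fin d → L2Space d) j x *
        fderiv ℝ φ x (EuclideanSpace.single j 1) = 0 := fun j => by
      refine integral_eq_zero_of_ae ?_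
      filter_upwards [h0] with x hx
      rw [Pi.zero_apply, hx, mul_zero, zero_mul, Pi.zero_apply]
    simp only [h1, h2, Finset.sum_const_zero, neg_zero]

end Helpers

/-- The unbounded operator `A v = div (c grad v)` in `L²(ℝᵈ)`, on the space of all `v ∈ H²(ℝᵈ)`
for which the distribution `div (c grad v)` is in `L²(ℝᵈ)`. That this space is all of `H²(ℝᵈ)`
for a given coefficient is not built into the definition. -/
def divGrad {d : ℕ} (c : C(EuclideanSpace ℝ (Fin d), ℝ)) : L2Space d →ₗ.[ℂ] L2Space d where
  domain :=
    { carrier := {v | ∃ w, IsDivGrad c v w}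
      add_mem' := fun ⟨w, hw⟩ ⟨w', hw'⟩ => ⟨w + w', hw.add hw'⟩
      zero_mem' := ⟨0, IsDivGrad.zero c⟩
      smul_mem' := fun a _ ⟨w, hw⟩ => ⟨a • w, hw.smul a⟩ }
  toFun :=
    { toFun := fun v => Classical.choose v.2
      map_add' := fun u v => (Classical.choose_spec (u + v).2).unique
        ((Classical.choose_spec u.2).add (Classical.choose_spec v.2))
      map_smul' := fun a v => (Classical.choose_spec (a • v).2).unique
        ((Classical.choose_spec v.2).smul a) }

/-- `divGrad c v` is the distribution `div (c grad v)`. -/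
theorem isDivGrad_divGrad {d : ℕ} (c : C(EuclideanSpace ℝ (Fin d), ℝ)) (v : (divGrad c).domain) :
    IsDivGrad c v (divGrad c v) :=
  Classical.choose_spec v.2

/-- `(T(z))_{z ∈ ℝ}` is a strongly continuous one-parameter group of unitary operators on `H`. -/
structure IsUnitaryGroup {H : Type*} [NormedAddCommGroup H] [InnerProductSpace ℂ H]
    (T : ℝ → (H ≃ₗᵢ[ℂ] H)) : Prop where
  map_zero : ∀ v, T 0 v = v
  map_add : ∀ s t v, T (s + t) v = T s (T t v)
  continuous : ∀ v, Continuous fun z => T z v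

/-- `B` is the (infinitesimal) generator of `(T(z))_{z ∈ ℝ}`: `v` is in the domain of `B` with
`B v = w` if and only if `(T(h) v - v) / h → w` in `H` as `h → 0`. -/
def IsGenerator {H : Type*} [NormedAddCommGroup H] [InnerProductSpace ℂ H]
    (B : H →ₗ.[ℂ] H) (T : ℝ → (H ≃ₗᵢ[ℂ] H)) : Prop :=
  ∀ v w : H, (∃ hv : v ∈ B.domain, B ⟨v, hv⟩ = w) ↔
    Tendsto (fun h : ℝ => h⁻¹ • (T h v - v)) (𝓝[≠] 0) (𝓝 w)

/-- The bounded operator `R`, defined on all of `H`, is the inverse of `B - μ : D(B) → H`. -/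
def IsResolvent {H : Type*} [NormedAddCommGroup H] [InnerProductSpace ℂ H]
    (B : H →ₗ.[ℂ] H) (μ : ℂ) (R : H →L[ℂ] H) : Prop :=
  (∀ v : H, ∃ hv : R v ∈ B.domain, B ⟨R v, hv⟩ - μ • R v = v) ∧
    ∀ u : B.domain, R (B u - μ • (u : H)) = u

end

/-! Everything reduces to one property, `IsSymmetricWithRange`: `A` is symmetric and `A - iμ` is
onto for every real `μ ≠ 0`. Symmetry gives `|μ| ‖v‖ ≤ ‖(A - iμ) v‖`, so the resolvents exist with
norm at most `1/|μ|`. The range condition makes the domain dense and forces `A* = A`. The group is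
the strong limit of `exp (i t Sₙ)` for the bounded self-adjoint operators `Sₙ = n² A (A² + n²)⁻¹`.

To verify the property for `A = div (c grad ·)`, write `v ∈ H²` as `v = (1 - Δ/4π²)⁻¹ u` with `u ∈
L²` (`mem_sobolevSpace_two_iff`); all operators then become bounded operators applied to `u`. By the
product rule `∂ⱼ(c₁ ∂ⱼ v) = c₁ ∂ⱼ² v + (∂ⱼ c₁)(∂ⱼ v)`, where `c₁` is bounded by Sobolev embedding,
`∂ⱼ c₁ ∈ Hʳ` and `∂ⱼ v ∈ H¹`. For `d ≤ 2` such a product lies in `L²`, and its norm is at most `δ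
‖u‖ + C_δ ‖v‖` for every `δ > 0` (`exists_productOp`, `exists_divGradOp`). Hence `A v ∈ L²` on all
of `H²`, and symmetry follows from two integrations by parts.

For the range, `c₁` is replaced by `t c₁` with `0 ≤ t ≤ 1`. Symmetry bounds `‖v‖` and `‖A v‖` by
`‖(A - iμ) v‖`; as `c₀ + t c₁ ≥ c₀`, the infinitesimal estimate then bounds `Δ v`, hence `u`,
uniformly in `t`. At `t = 0` the equation is solved by a Fourier multiplier, and the method of
continuity reaches `t = 1` (`surjective_divGradOp_sub`). -/

noncomputable section

/-! ### Exponentials of bounded self-adjoint operators -/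

section BoundedGroup

variable {H : Type*} [NormedAddCommGroup H] [InnerProductSpace ℂ H] [CompleteSpace H]

/-- The unitary group `exp (i t S)` of a bounded self-adjoint operator `S`. -/
def expGroup (S : H →L[ℂ] H) (t : ℝ) : H →L[ℂ] H := NormedSpace.exp (t • (Complex.I • S))

theorem expGroup_zero (S : H →L[ℂ] H) : expGroup S 0 = 1 := by
  simp [expGroup]

theorem expGroup_add (S : H →L[ℂ] H) (s t : ℝ) :
    expGroup S (s + t) = expGroup S s * expGroup S t := by
  let +nondep : NormedAlgebra ℚ (H →L[ℂ] H) := .restrictScalars ℚ ℂ _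
  rw [expGroup, add_smul]
  exact NormedSpace.exp_add_of_commute (((Commute.refl _).smul_left s).smul_right t)

theorem norm_expGroup_apply {S : H →L[ℂ] H} (hS : IsSelfAdjoint S) (t : ℝ) (v : H) :
    ‖expGroup S t v‖ = ‖v‖ := by
  have h : expGroup S t = selfAdjoint.expUnitary ⟨t • S, (IsSelfAdjoint.all t).smul hS⟩ := by
    rw [selfAdjoint.expUnitary_coe, expGroup, smul_comm]
  rw [h]
  exact ContinuousLinearMap.norm_map_of_mem_unitary (Subtype.prop _) v

theorem hasDerivAt_expGroup (S : H →L[ℂ] H) (v : H) (t : ℝ) :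
    HasDerivAt (fun s => expGroup S s v) (expGroup S t (Complex.I • S v)) t := by
  have h := hasDerivAt_exp_smul_const (𝕂 := ℝ) (Complex.I • S) t
  have h2 := ((ContinuousLinearMap.apply ℂ H v).restrictScalars ℝ).hasFDerivAt.comp_hasDerivAt t h
  simpa [expGroup] using! h2

theorem norm_expGroup_sub_le {S : H →L[ℂ] H} (hS : IsSelfAdjoint S) (t : ℝ) (v : H) :
    ‖expGroup S t v - v‖ ≤ |t| * ‖S v‖ := by
  have h := convex_univ.norm_image_sub_le_of_norm_hasDerivWithin_le (x := 0) (y := t)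
    (f := fun s => expGroup S s v) (C := ‖S v‖)
    (fun x _ => (hasDerivAt_expGroup S v x).hasDerivWithinAt)
    (fun x _ => by rw [norm_expGroup_apply hS, norm_smul, Complex.norm_I, one_mul])
    (Set.mem_univ _) (Set.mem_univ _)
  simpa [expGroup_zero, mul_comm] using h

/-- First-order Taylor estimate for `exp (i t S) v`, where `S v` is compared to a vector `w`. -/
theorem norm_expGroup_sub_sub_le {S : H →L[ℂ] H} (hS : IsSelfAdjoint S) (t : ℝ) (v w : H) :
    ‖expGroup S t v - v - t • (Complex.I • S v)‖ ≤ |t| * (2 * ‖S v - w‖ + |t| * ‖S w‖) := by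
  have hd : ∀ s : ℝ, HasDerivAt (fun s => expGroup S s v - s • (Complex.I • S v))
      (expGroup S s (Complex.I • S v) - Complex.I • S v) s := fun s => by
    simpa using! (hasDerivAt_expGroup S v s).sub ((hasDerivAt_id s).smul_const (Complex.I • S v))
  have hb : ∀ s ∈ Set.uIcc 0 t, ‖expGroup S s (Complex.I • S v) - Complex.I • S v‖ ≤
      2 * ‖S v - w‖ + |t| * ‖S w‖ := fun s hs => by
    have hst : |s| ≤ |t| := by simpa using Set.abs_sub_left_of_mem_uIcc hs
    rw [map_smul, ← smul_sub, norm_smul, Complex.norm_I, one_mul]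
    -- The difference `S v - w` is estimated by isometry alone, so `S` is applied twice to nothing.
    -- In the limit `S → A`, the vector `A v` may lie outside the domain, and `w` is a domain vector
    -- near it.
    have e : expGroup S s (S v) - S v =
        (expGroup S s (S v - w) - (S v - w)) + (expGroup S s w - w) := by
      rw [map_sub]; abel
    rw [e]
    refine (norm_add_le _ _).trans (add_le_add ?_ ?_)
    · refine (norm_sub_le _ _).trans ?_
      rw [norm_expGroup_apply hS, two_mul]
    · exact (norm_expGroup_sub_le hS s w).trans (by gcongr)
  have h := (convex_uIcc (0 : ℝ) t).norm_image_sub_le_of_norm_hasDerivWithin_le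
    (fun x _ => (hd x).hasDerivWithinAt) hb Set.left_mem_uIcc Set.right_mem_uIcc
  simp only [expGroup_zero, zero_smul, sub_zero, Real.norm_eq_abs] at h
  rw [mul_comm, sub_right_comm]
  exact h

/-- Commutation gives `exp (itS) = exp (itS') exp (it(S - S'))`, and the first factor is isometric.
This makes the approximating groups Cauchy on the domain of `A`. -/
theorem norm_expGroup_sub_expGroup_le {S S' : H →L[ℂ] H} (hS : IsSelfAdjoint S)
    (hS' : IsSelfAdjoint S') (hc : Commute S S') (t : ℝ) (v : H) :
    ‖expGroup S t v - expGroup S' t v‖ ≤ |t| * ‖S v - S' v‖ := by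
  let +nondep : NormedAlgebra ℚ (H →L[ℂ] H) := .restrictScalars ℚ ℂ _
  have e : expGroup S t = expGroup S' t * expGroup (S - S') t := by
    have h1 : t • (Complex.I • S) = t • (Complex.I • S') + t • (Complex.I • (S - S')) := by
      rw [smul_sub, smul_sub]; abel
    rw [expGroup, h1]
    refine NormedSpace.exp_add_of_commute ?_
    have : Commute S' (S - S') := hc.symm.sub_right (Commute.refl _)
    exact (((this.smul_left _).smul_left _).smul_right _).smul_right _
  rw [e, mul_apply_eq_comp, ← map_sub, norm_expGroup_apply hS']
  exact norm_expGroup_sub_le (hS.sub hS') t v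

end BoundedGroup

/-! ### Symmetric operators with range condition -/

section Symmetric

variable {H : Type*} [NormedAddCommGroup H] [InnerProductSpace ℂ H] {A : H →ₗ.[ℂ] H}

open scoped ComplexInnerProductSpace

/-- A symmetric operator `A` such that `A - iμ` is onto for every real `μ ≠ 0`. -/
structure IsSymmetricWithRange (A : H →ₗ.[ℂ] H) : Prop where
  symm : A.IsFormalAdjoint A
  surj : ∀ μ : ℝ, μ ≠ 0 → ∀ w : H, ∃ u : A.domain, A u - (μ * Complex.I) • (u : H) = w

/-- The imaginary part of `⟪u, w - iμu⟫` is `-μ ‖u‖²`; Cauchy–Schwarz does the rest. The form with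
two vectors also serves the a priori estimate, where `w` is not yet written as an operator with
domain applied to `u`. -/
theorem abs_mul_norm_le_of_real_inner {u w : H} (h : (⟪u, w⟫).im = 0) (μ : ℝ) :
    |μ| * ‖u‖ ≤ ‖w - ((μ : ℂ) * Complex.I) • u‖ := by
  rcases eq_or_ne u 0 with rfl | hu
  · simp
  have e : (⟪u, w - ((μ : ℂ) * Complex.I) • u⟫).im = -(μ * ‖u‖ ^ 2) := by
    have h1 : ⟪u, u⟫ = ((‖u‖ ^ 2 : ℝ) : ℂ) := by
      rw [inner_self_eq_norm_sq_to_K]; norm_cast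
    rw [inner_sub_right, inner_smul_right, h1, Complex.sub_im, h, mul_right_comm,
      ← Complex.ofReal_mul, Complex.im_ofReal_mul, Complex.I_im, mul_one, zero_sub]
  have h2 : |μ| * ‖u‖ ^ 2 ≤ ‖u‖ * ‖w - ((μ : ℂ) * Complex.I) • u‖ := by
    have h3 := (Complex.abs_im_le_norm _).trans
      (norm_inner_le_norm (𝕜 := ℂ) u (w - ((μ : ℂ) * Complex.I) • u))
    rwa [e, abs_neg, abs_mul, abs_of_nonneg (sq_nonneg ‖u‖)] at h3
  have hp : 0 < ‖u‖ := norm_pos_iff.2 hu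
  nlinarith

namespace IsSymmetricWithRange

theorem inner_im (hA : IsSymmetricWithRange A) (u : A.domain) : (⟪(u : H), A u⟫).im = 0 := by
  have h := hA.symm u u
  rw [← inner_conj_symm] at h
  exact Complex.conj_eq_iff_im.1 h

theorem abs_mul_norm_le (hA : IsSymmetricWithRange A) (μ : ℝ) (u : A.domain) :
    |μ| * ‖(u : H)‖ ≤ ‖A u - ((μ : ℂ) * Complex.I) • (u : H)‖ :=
  abs_mul_norm_le_of_real_inner (hA.inner_im u) μ

theorem injective (hA : IsSymmetricWithRange A) {μ : ℝ} (hμ : μ ≠ 0) {u v : A.domain}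
    (h : A u - ((μ : ℂ) * Complex.I) • (u : H) = A v - ((μ : ℂ) * Complex.I) • (v : H)) :
    u = v := by
  have h1 := hA.abs_mul_norm_le μ (u - v)
  have h2 : A (u - v) - ((μ : ℂ) * Complex.I) • ((u - v : A.domain) : H) = 0 := by
    rw [LinearPMap.map_sub, Submodule.coe_sub, smul_sub, sub_sub_sub_comm, h, sub_self]
  rw [h2, norm_zero] at h1
  have h3 : ‖((u - v : A.domain) : H)‖ = 0 := by
    have := abs_pos.2 hμ
    nlinarith [norm_nonneg ((u - v : A.domain) : H)]
  have h4 : u - v = 0 := Subtype.ext (norm_eq_zero.1 h3)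
  exact sub_eq_zero.1 h4

theorem exists_resolvent (hA : IsSymmetricWithRange A) {μ : ℝ} (hμ : μ ≠ 0) :
    ∃ R : H →L[ℂ] H, IsResolvent A (μ * Complex.I) R ∧ ∀ v, ‖R v‖ ≤ ‖v‖ / |μ| := by
  choose f hf using hA.surj μ hμ
  have hb : ∀ v, ‖(f v : H)‖ ≤ |μ|⁻¹ * ‖v‖ := fun v => by
    rw [inv_mul_eq_div, le_div_iff₀ (abs_pos.2 hμ), mul_comm]
    simpa only [hf] using hA.abs_mul_norm_le μ (f v)
  let L : H →ₗ[ℂ] H :=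
    { toFun := fun v => f v
      map_add' := fun u v => by
        rw [← Submodule.coe_add]
        congr 1
        refine hA.injective hμ ?_
        rw [hf, LinearPMap.map_add, Submodule.coe_add, smul_add, add_sub_add_comm, hf, hf]
      map_smul' := fun a v => by
        rw [RingHom.id_apply, ← Submodule.coe_smul]
        congr 1
        refine hA.injective hμ ?_
        rw [hf, LinearPMap.map_smul, Submodule.coe_smul, smul_comm, ← smul_sub, hf] }
  refine ⟨L.mkContinuous |μ|⁻¹ hb, ⟨fun v => ⟨(f v).2, hf v⟩, fun u => ?_⟩, fun v => ?_⟩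
  · exact congrArg Subtype.val (hA.injective hμ (hf _))
  · rw [← inv_mul_eq_div]
    exact hb v

/-- If `w` is orthogonal to the domain and `(A - i) x = w`, then `0 = Im ⟪x, w⟫ = -‖x‖²`, so `x` and
`w` vanish. -/
theorem dense_domain [CompleteSpace H] (hA : IsSymmetricWithRange A) :
    Dense (A.domain : Set H) := by
  rw [Submodule.dense_iff_topologicalClosure_eq_top, Submodule.topologicalClosure_eq_top_iff,
    Submodule.eq_bot_iff]
  intro w hw
  obtain ⟨x, hx⟩ := hA.surj 1 one_ne_zero w
  have h0 : ⟪(x : H), w⟫ = 0 := hw x x.2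
  have e : (⟪(x : H), w⟫).im = -‖(x : H)‖ ^ 2 := by
    rw [← hx, inner_sub_right, inner_smul_right, inner_self_eq_norm_sq_to_K, Complex.sub_im,
      hA.inner_im]
    simp
    norm_cast
  rw [h0] at e
  have h3 : (x : H) = 0 := by
    rw [← norm_eq_zero]
    simpa using e.symm
  have h4 : x = 0 := Subtype.ext h3
  rw [← hx, h4]
  simp

/-- For `y` in the domain of `A*`, solve `(A - i) x = (A* - i) y`. Then `y - x` lies in the kernel
of `A* - i`, which is orthogonal to the range of `A + i`, that is, to everything; so `y = x`. -/
theorem isSelfAdjoint [CompleteSpace H] (hA : IsSymmetricWithRange A) : IsSelfAdjoint A := by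
  have hd := hA.dense_domain
  rw [LinearPMap.isSelfAdjoint_def]
  refine (LinearPMap.eq_of_le_of_domain_eq (hA.symm.le_adjoint hd) ?_).symm
  refine le_antisymm (hA.symm.le_adjoint hd).1 fun y hy => ?_
  obtain ⟨x, hx⟩ := hA.surj 1 one_ne_zero
    (A.adjoint ⟨y, hy⟩ - (((1 : ℝ) : ℂ) * Complex.I) • y)
  suffices h : y = x by rw [h]; exact x.2
  obtain ⟨u, hu⟩ := hA.surj (-1) (by norm_num) (y - x)
  have h1 : ⟪A.adjoint ⟨y, hy⟩, (u : H)⟫ = ⟪y, A u⟫ :=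
    LinearPMap.adjoint_isFormalAdjoint hd ⟨y, hy⟩ u
  have h2 : ⟪A x, (u : H)⟫ = ⟪(x : H), A u⟫ := hA.symm x u
  have h3 : ⟪A x - A.adjoint ⟨y, hy⟩, (u : H)⟫ =
      ⟪((1 : ℝ) * Complex.I : ℂ) • ((x : H) - y), (u : H)⟫ := by
    congr 1
    rw [smul_sub, sub_eq_sub_iff_sub_eq_sub]
    exact hx
  have h4 : ⟪y - x, y - x⟫ = 0 := by
    nth_rw 2 [← hu]
    rw [inner_sub_right, inner_smul_right]
    rw [inner_sub_left, h1, h2, inner_smul_left, inner_sub_left] at h3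
    rw [inner_sub_left, inner_sub_left]
    simp at h3 ⊢
    linear_combination -h3
  exact sub_eq_zero.1 (inner_self_eq_zero.1 h4)

end IsSymmetricWithRange
end Symmetric

/-! ### Stone's theorem for symmetric operators with range condition -/

section Stone

/-- An `ε/3` argument, used to pass from the domain of `A` to all of `H`. -/
theorem tendsto_of_dense_of_contraction {H : Type*} [SeminormedAddCommGroup H]
    {F : ℕ → H → H} {f : H → H} {D : Set H} (hD : Dense D)
    (hF : ∀ n u v, ‖F n u - F n v‖ ≤ ‖u - v‖) (hf : ∀ u v, ‖f u - f v‖ ≤ ‖u - v‖)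
    (h : ∀ u ∈ D, Tendsto (fun n => F n u) atTop (𝓝 (f u))) (v : H) :
    Tendsto (fun n => F n v) atTop (𝓝 (f v)) := by
  rw [Metric.tendsto_atTop]
  intro ε hε
  obtain ⟨u, hu, huv⟩ := hD.exists_dist_lt v (ε := ε / 3) (by positivity)
  obtain ⟨N, hN⟩ := Metric.tendsto_atTop.1 (h u hu) (ε / 3) (by positivity)
  refine ⟨N, fun n hn => ?_⟩
  have h1 := hN n hn
  have h2 := hF n v u
  have h3 := hf u v
  have h4 := dist_triangle4 (F n v) (F n u) (f u) (f v)
  simp only [← dist_eq_norm] at h2 h3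
  rw [dist_comm u v] at h3
  linarith

theorem cauchySeq_of_dense_of_contraction {H : Type*} [SeminormedAddCommGroup H]
    {F : ℕ → H → H} {D : Set H} (hD : Dense D)
    (hF : ∀ n u v, ‖F n u - F n v‖ ≤ ‖u - v‖) (h : ∀ u ∈ D, CauchySeq fun n => F n u) (v : H) :
    CauchySeq fun n => F n v := by
  rw [Metric.cauchySeq_iff]
  intro ε hε
  obtain ⟨u, hu, huv⟩ := hD.exists_dist_lt v (ε := ε / 3) (by positivity)
  obtain ⟨N, hN⟩ := Metric.cauchySeq_iff.1 (h u hu) (ε / 3) (by positivity)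
  refine ⟨N, fun m hm n hn => ?_⟩
  have h1 := hN m hm n hn
  have h2 := hF m v u
  have h3 := hF n u v
  have h4 := dist_triangle4 (F m v) (F m u) (F n u) (F n v)
  simp only [← dist_eq_norm] at h2 h3
  rw [dist_comm u v] at h3
  linarith

variable {H : Type*} [NormedAddCommGroup H] [InnerProductSpace ℂ H]

open scoped ComplexInnerProductSpace

variable {A : H →ₗ.[ℂ] H} {R : ℝ → H →L[ℂ] H}

namespace IsSymmetricWithRange

theorem norm_resolvent_le (hA : IsSymmetricWithRange A) {μ : ℝ}
    {Q : H →L[ℂ] H} (hQ : IsResolvent A (μ * Complex.I) Q) (v : H) : |μ| * ‖Q v‖ ≤ ‖v‖ := by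
  obtain ⟨hv, e⟩ := hQ.1 v
  simpa only [e] using hA.abs_mul_norm_le μ ⟨Q v, hv⟩

theorem inner_resolvent (hA : IsSymmetricWithRange A)
    (hR : ∀ μ : ℝ, μ ≠ 0 → IsResolvent A (μ * Complex.I) (R μ)) {μ : ℝ} (hμ : μ ≠ 0) (x y : H) :
    ⟪R μ x, y⟫ = ⟪x, R (-μ) y⟫ := by
  obtain ⟨h1, e1⟩ := (hR μ hμ).1 x
  obtain ⟨h2, e2⟩ := (hR (-μ) (neg_ne_zero.2 hμ)).1 y
  have h3 := hA.symm ⟨R μ x, h1⟩ ⟨R (-μ) y, h2⟩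
  nth_rw 1 [← e2]
  nth_rw 2 [← e1]
  rw [inner_sub_left, inner_sub_right, inner_smul_left, inner_smul_right]
  simp only [map_mul, Complex.conj_ofReal, Complex.conj_I, Complex.ofReal_neg]
  rw [← h3]
  ring

theorem resolvent_map_apply {Q : H →L[ℂ] H} {z : ℂ} (hQ : IsResolvent A z Q) (u : A.domain) :
    Q (A u) = u + z • Q u := by
  have h := hQ.2 u
  rw [map_sub, map_smul] at h
  exact sub_eq_iff_eq_add.1 h

theorem map_resolvent {Q : H →L[ℂ] H} {z : ℂ} (hQ : IsResolvent A z Q) (u : A.domain) :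
    ∃ h : Q u ∈ A.domain, A ⟨Q u, h⟩ = Q (A u) := by
  obtain ⟨h, e⟩ := hQ.1 u
  refine ⟨h, ?_⟩
  rw [resolvent_map_apply hQ, ← sub_eq_iff_eq_add]
  exact e

/-- `Q'` preserves the domain and commutes with `A` there, so `Q' Q x` solves `(A - z) y = Q' x`,
whose solution is `Q Q' x`. -/
theorem commute_resolvent {Q Q' : H →L[ℂ] H} {z z' : ℂ} (hQ : IsResolvent A z Q)
    (hQ' : IsResolvent A z' Q') : Commute Q Q' := by
  refine ContinuousLinearMap.ext fun x => ?_
  obtain ⟨h, e⟩ := hQ.1 x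
  obtain ⟨h', e'⟩ := map_resolvent hQ' ⟨Q x, h⟩
  have h2 := hQ.2 ⟨Q' (Q x), h'⟩
  rw [e'] at h2
  have e2 : Q' (A ⟨Q x, h⟩) - z • Q' (Q x) = Q' x := by
    rw [← map_smul Q', ← map_sub Q', e]
  exact (congrArg Q e2).symm.trans h2

/-- The bounded symmetric approximations `n² A (A² + n²)⁻¹` of `A`, with `n + 1` in place
of `n`. -/
def approx (R : ℝ → H →L[ℂ] H) (n : ℕ) : H →L[ℂ] H :=
  (((n : ℝ) + 1) ^ 2 / 2) • (R (n + 1) + R (-(n + 1)))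

theorem approx_isSelfAdjoint [CompleteSpace H] (hA : IsSymmetricWithRange A)
    (hR : ∀ μ : ℝ, μ ≠ 0 → IsResolvent A (μ * Complex.I) (R μ)) (n : ℕ) :
    IsSelfAdjoint (approx R n) := by
  have h0 : (n : ℝ) + 1 ≠ 0 := by positivity
  refine (IsSelfAdjoint.all _).smul ?_
  rw [ContinuousLinearMap.isSelfAdjoint_iff_isSymmetric]
  intro x y
  change ⟪(R (n + 1) + R (-(n + 1))) x, y⟫ = ⟪x, (R (n + 1) + R (-(n + 1))) y⟫
  rw [add_apply, add_apply, inner_add_left,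
    inner_add_right, hA.inner_resolvent hR h0, hA.inner_resolvent hR (neg_ne_zero.2 h0),
    neg_neg, add_comm]

theorem approx_commute (hR : ∀ μ : ℝ, μ ≠ 0 → IsResolvent A (μ * Complex.I) (R μ)) (m n : ℕ) :
    Commute (approx R m) (approx R n) := by
  have h : ∀ k : ℕ, (k : ℝ) + 1 ≠ 0 := fun k => by positivity
  have hc : ∀ μ ν : ℝ, μ ≠ 0 → ν ≠ 0 → Commute (R μ) (R ν) := fun μ ν hμ hν =>
    commute_resolvent (hR μ hμ) (hR ν hν)
  refine Commute.smul_left (Commute.smul_right ?_ _) _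
  exact ((hc _ _ (h m) (h n)).add_right (hc _ _ (h m) (neg_ne_zero.2 (h n)))).add_left
    ((hc _ _ (neg_ne_zero.2 (h m)) (h n)).add_right
      (hc _ _ (neg_ne_zero.2 (h m)) (neg_ne_zero.2 (h n))))

theorem approx_apply (hR : ∀ μ : ℝ, μ ≠ 0 → IsResolvent A (μ * Complex.I) (R μ)) (n : ℕ)
    (u : A.domain) : approx R n u = (2⁻¹ : ℂ) •
      ((-(((n : ℝ) + 1 : ℝ) * Complex.I)) • R (n + 1) (A u) +
        (-((-((n : ℝ) + 1) : ℝ) * Complex.I)) • R (-(n + 1)) (A u)) := by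
  have h0 : (n : ℝ) + 1 ≠ 0 := by positivity
  rw [resolvent_map_apply (hR _ h0), resolvent_map_apply (hR _ (neg_ne_zero.2 h0)), approx,
    smul_apply, add_apply, ← Complex.coe_smul]
  generalize R (n + 1) u = x
  generalize R (-(n + 1)) u = y
  have hI : Complex.I ^ 2 = -1 := Complex.I_sq
  match_scalars <;> ring_nf <;> simp only [hI] <;> ring

/-- On the domain `-iμ R(μ) u = u - R(μ) A u`, and `‖R(μ)‖ ≤ 1/|μ|`. The operators `-iμ R(μ)` are
contractions, so the limit extends by density. -/
theorem tendsto_smul_resolvent [CompleteSpace H] (hA : IsSymmetricWithRange A)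
    (hR : ∀ μ : ℝ, μ ≠ 0 → IsResolvent A (μ * Complex.I) (R μ)) {f : ℕ → ℝ} (hf0 : ∀ n, f n ≠ 0)
    (hf : Tendsto (fun n => |f n|) atTop atTop) (v : H) :
    Tendsto (fun n => (-(f n * Complex.I)) • R (f n) v) atTop (𝓝 v) := by
  refine tendsto_of_dense_of_contraction (F := fun n v => (-(f n * Complex.I)) • R (f n) v)
    (f := id) hA.dense_domain (fun n u v => ?_) (fun u v => le_rfl) (fun u hu => ?_) v
  · rw [← smul_sub, ← map_sub, norm_smul, norm_neg, norm_mul, Complex.norm_I, mul_one,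
      Complex.norm_real]
    exact hA.norm_resolvent_le (hR _ (hf0 n)) _
  · have e : ∀ n, (-(f n * Complex.I)) • R (f n) u = u - R (f n) (A ⟨u, hu⟩) := fun n => by
      rw [resolvent_map_apply (hR _ (hf0 n)), neg_smul]
      abel
    simp only [e, id]
    have h0 : Tendsto (fun n => R (f n) (A ⟨u, hu⟩)) atTop (𝓝 0) := by
      have h1 : Tendsto (fun n => |f n|⁻¹ * ‖A ⟨u, hu⟩‖) atTop (𝓝 0) := by
        simpa using hf.inv_tendsto_atTop.mul_const ‖A ⟨u, hu⟩‖
      refine squeeze_zero_norm (fun n => ?_) h1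
      rw [inv_mul_eq_div, le_div_iff₀ (abs_pos.2 (hf0 n)), mul_comm]
      exact hA.norm_resolvent_le (hR _ (hf0 n)) _
    simpa using h0.const_sub u

theorem tendsto_approx [CompleteSpace H] (hA : IsSymmetricWithRange A)
    (hR : ∀ μ : ℝ, μ ≠ 0 → IsResolvent A (μ * Complex.I) (R μ)) (u : A.domain) :
    Tendsto (fun n => approx R n u) atTop (𝓝 (A u)) := by
  have h0 : ∀ n : ℕ, (n : ℝ) + 1 ≠ 0 := fun n => by positivity
  have hl : Tendsto (fun n : ℕ => |(n : ℝ) + 1|) atTop atTop :=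
    tendsto_abs_atTop_atTop.comp (tendsto_atTop_add_const_right _ _ tendsto_natCast_atTop_atTop)
  have h1 := hA.tendsto_smul_resolvent hR (f := fun n => n + 1) h0 hl (A u)
  have h2 := hA.tendsto_smul_resolvent hR (f := fun n => -(n + 1))
    (fun n => neg_ne_zero.2 (h0 n)) (by simpa only [abs_neg] using hl) (A u)
  have h3 := (h1.add h2).const_smul (2⁻¹ : ℂ)
  have e : (2⁻¹ : ℂ) • (A u + A u) = A u := by
    rw [← two_smul ℂ, smul_smul]; norm_num
  rw [e] at h3
  exact h3.congr fun n => (approx_apply hR n u).symm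

/-- **Stone's theorem**, existence part: `iA` generates a strongly continuous unitary group. -/
theorem exists_unitaryGroup [CompleteSpace H] (hA : IsSymmetricWithRange A) :
    ∃ T : ℝ → (H ≃ₗᵢ[ℂ] H), IsUnitaryGroup T ∧ IsGenerator (Complex.I • A) T := by
  classical
  have hex : ∀ μ : ℝ, ∃ Q : H →L[ℂ] H, μ ≠ 0 → IsResolvent A (μ * Complex.I) Q := fun μ => by
    by_cases hμ : μ = 0
    · exact ⟨0, fun h => absurd hμ h⟩
    · obtain ⟨Q, hQ, -⟩ := hA.exists_resolvent hμ
      exact ⟨Q, fun _ => hQ⟩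
  choose R hR using hex
  have hS : ∀ n, IsSelfAdjoint (approx R n) := hA.approx_isSelfAdjoint hR
  have hcontr : ∀ (t : ℝ) n u v, ‖expGroup (approx R n) t u - expGroup (approx R n) t v‖ ≤
      ‖u - v‖ := fun t n u v => by
    rw [← map_sub, norm_expGroup_apply (hS n)]
  have hcauchy : ∀ (t : ℝ) v, CauchySeq fun n => expGroup (approx R n) t v := fun t v => by
    refine cauchySeq_of_dense_of_contraction (F := fun n => expGroup (approx R n) t)
      hA.dense_domain (hcontr t) (fun u hu => ?_) v
    have h1 := (hA.tendsto_approx hR ⟨u, hu⟩).cauchySeq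
    rw [Metric.cauchySeq_iff] at h1 ⊢
    intro ε hε
    obtain ⟨N, hN⟩ := h1 (ε / (|t| + 1)) (by positivity)
    refine ⟨N, fun m hm n hn => ?_⟩
    rw [dist_eq_norm]
    refine (norm_expGroup_sub_expGroup_le (hS m) (hS n) (approx_commute hR m n) t u).trans_lt ?_
    have h2 := hN m hm n hn
    rw [dist_eq_norm, lt_div_iff₀ (by positivity)] at h2
    nlinarith [norm_nonneg (approx R m u - approx R n u)]
  choose T hT using fun t v => cauchySeq_tendsto_of_complete (hcauchy t v)
  have hnorm : ∀ t v, ‖T t v‖ = ‖v‖ := fun t v => by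
    refine tendsto_nhds_unique (hT t v).norm ?_
    simp only [norm_expGroup_apply (hS _)]
    exact tendsto_const_nhds
  have hadd : ∀ t u v, T t (u + v) = T t u + T t v := fun t u v => by
    refine tendsto_nhds_unique (hT t (u + v)) ?_
    simpa only [map_add] using (hT t u).add (hT t v)
  have hsmul : ∀ t (a : ℂ) v, T t (a • v) = a • T t v := fun t a v => by
    refine tendsto_nhds_unique (hT t (a • v)) ?_
    simpa only [map_smul] using (hT t v).const_smul a
  have hzero : ∀ v, T 0 v = v := fun v => by
    refine tendsto_nhds_unique (hT 0 v) ?_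
    simp [expGroup_zero]
  have hgroup : ∀ s t v, T (s + t) v = T s (T t v) := fun s t v => by
    refine tendsto_nhds_unique (hT (s + t) v) ?_
    have h1 : Tendsto (fun n => expGroup (approx R n) s (expGroup (approx R n) t v) -
        expGroup (approx R n) s (T t v)) atTop (𝓝 0) := by
      refine squeeze_zero_norm (fun n => hcontr s n _ _) ?_
      simpa using ((hT t v).sub_const (T t v)).norm
    simpa [expGroup_add] using h1.add (hT s (T t v))
  let U : ℝ → (H ≃ₗᵢ[ℂ] H) := fun t =>
    { toFun := T t
      map_add' := hadd t
      map_smul' := hsmul t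
      invFun := T (-t)
      left_inv := fun v => by rw [← hgroup, neg_add_cancel, hzero]
      right_inv := fun v => by rw [← hgroup, add_neg_cancel, hzero]
      norm_map' := hnorm t }
  have hUT : ∀ t v, U t v = T t v := fun _ _ => rfl
  have hTcontr : ∀ t u v, ‖T t u - T t v‖ ≤ ‖u - v‖ := fun t u v => by
    rw [← hUT, ← hUT, ← map_sub, LinearIsometryEquiv.norm_map]
  have hlip : ∀ (u : A.domain) t, ‖T t u - u‖ ≤ |t| * ‖A u‖ := fun u t => by
    refine le_of_tendsto_of_tendsto' ((hT t u).sub_const (u : H)).norm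
      ((hA.tendsto_approx hR u).norm.const_mul |t|) fun n => norm_expGroup_sub_le (hS n) t u
  have hcont0 : ∀ v, Tendsto (fun t => T t v) (𝓝 0) (𝓝 v) := fun v => by
    rw [Metric.tendsto_nhds_nhds]
    intro ε hε
    obtain ⟨u, hu, huv⟩ := hA.dense_domain.exists_dist_lt v (ε := ε / 3) (by positivity)
    refine ⟨ε / 3 / (‖A ⟨u, hu⟩‖ + 1), by positivity, fun {t} ht => ?_⟩
    rw [dist_zero_right, Real.norm_eq_abs, lt_div_iff₀ (by positivity)] at ht
    have h1 := hlip ⟨u, hu⟩ t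
    have h2 := hTcontr t v u
    have h3 := dist_triangle4 (T t v) (T t u) u v
    simp only [← dist_eq_norm] at h1 h2
    rw [dist_comm u v] at h3
    nlinarith [abs_nonneg t]
  have hcont : ∀ v, Continuous fun t => T t v := fun v => by
    rw [continuous_iff_continuousAt]
    intro s
    have h1 : Tendsto (fun t => t - s) (𝓝 s) (𝓝 0) := by
      simpa using (tendsto_id (x := 𝓝 s)).sub_const s
    have h2 := (hcont0 (T s v)).comp h1
    refine h2.congr fun t => ?_
    rw [Function.comp_apply, ← hgroup, sub_add_cancel]
  -- With `w` close to `A v` the right-hand side is `o(t)`, and it does not require `A v` to be in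
  -- the domain.
  have htaylor : ∀ (v : A.domain) (w : A.domain) t, ‖T t v - v - t • (Complex.I • A v)‖ ≤
      |t| * (2 * ‖A v - w‖ + |t| * ‖A w‖) := fun v w t => by
    refine le_of_tendsto_of_tendsto' (((hT t v).sub_const (v : H)).sub
      (((hA.tendsto_approx hR v).const_smul Complex.I).const_smul t)).norm
      (((((hA.tendsto_approx hR v).sub_const (w : H)).norm.const_mul 2).add
      ((hA.tendsto_approx hR w).norm.const_mul |t|)).const_mul |t|)
      fun n => norm_expGroup_sub_sub_le (hS n) t v w
  have hderiv : ∀ v : A.domain, Tendsto (fun h : ℝ => h⁻¹ • (T h v - v)) (𝓝[≠] 0)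
      (𝓝 (Complex.I • A v)) := fun v => by
    rw [Metric.tendsto_nhdsWithin_nhds]
    intro ε hε
    obtain ⟨w, hw, hvw⟩ := hA.dense_domain.exists_dist_lt (A v) (ε := ε / 4) (by positivity)
    refine ⟨ε / 2 / (‖A ⟨w, hw⟩‖ + 1), by positivity, fun {t} ht0 ht => ?_⟩
    have ht0' : t ≠ 0 := ht0
    have hpos := abs_pos.2 ht0'
    rw [dist_zero_right, Real.norm_eq_abs, lt_div_iff₀ (by positivity)] at ht
    have h1 := htaylor v ⟨w, hw⟩ t
    have e : t⁻¹ • (T t v - v) - Complex.I • A v = t⁻¹ • (T t v - v - t • (Complex.I • A v)) := by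
      rw [smul_sub t⁻¹ (T t v - v), inv_smul_smul₀ ht0']
    rw [dist_eq_norm, e, norm_smul, norm_inv, Real.norm_eq_abs, inv_mul_lt_iff₀ hpos]
    refine h1.trans_lt (mul_lt_mul_of_pos_left ?_ hpos)
    rw [dist_eq_norm] at hvw
    simp only
    linarith
  refine ⟨U, ⟨hzero, hgroup, hcont⟩, fun v w => ⟨?_, fun h => ?_⟩⟩
  · rintro ⟨hv, rfl⟩
    exact hderiv ⟨v, hv⟩
  -- The generator extends `iA`, and `iA - 1` is onto. Choosing `u` with `(iA - 1) u = w - v` makes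
  -- `x = v - u` satisfy `(T h x - x)/h → x`. Since `T` is isometric, `Re ⟪x, T h x - x⟫ ≤ 0`;
  -- dividing by `h > 0` gives `‖x‖² ≤ 0`.
  · obtain ⟨u, hu⟩ := hA.surj (-1) (by norm_num) (Complex.I • (v - w))
    have hlim := h.sub (hderiv u)
    have hz : w - Complex.I • A u = v - u := by
      have h1 : A u = Complex.I • (v - w) - Complex.I • (u : H) := by
        rw [← hu]; simp
      rw [h1, smul_sub, smul_smul, smul_smul, Complex.I_mul_I, neg_one_smul, neg_one_smul]
      abel
    rw [hz] at hlim
    have h2 : Tendsto (fun t : ℝ => (⟪v - (u : H), t⁻¹ • (T t (v - u) - (v - u))⟫).re) (𝓝[>] 0)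
        (𝓝 (‖v - (u : H)‖ ^ 2)) := by
      have h3 : Tendsto (fun t : ℝ => t⁻¹ • (T t (v - u) - (v - u))) (𝓝[>] 0) (𝓝 (v - u)) := by
        refine (hlim.mono_left (nhdsWithin_mono _ fun t ht => ne_of_gt ht)).congr fun t => ?_
        rw [← hUT, ← hUT, map_sub, hUT, ← smul_sub]
        congr 1
        abel
      have h4 := (Complex.continuous_re.tendsto _).comp
        (tendsto_const_nhds.inner (𝕜 := ℂ) h3 (f := fun _ => v - (u : H)))
      have e : (⟪v - (u : H), v - (u : H)⟫).re = ‖v - (u : H)‖ ^ 2 := by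
        rw [inner_self_eq_norm_sq_to_K]; norm_cast
      rw [e] at h4
      exact h4
    have h5 : ‖v - (u : H)‖ ^ 2 ≤ 0 := by
      refine le_of_tendsto h2 ?_
      filter_upwards [self_mem_nhdsWithin] with t ht
      have ht : 0 < t := ht
      rw [← Complex.coe_smul, inner_smul_right, Complex.re_ofReal_mul, inner_sub_right,
        Complex.sub_re]
      have h6 : (⟪v - (u : H), T t (v - u)⟫).re ≤ ‖v - (u : H)‖ ^ 2 := by
        refine (Complex.re_le_norm _).trans ((norm_inner_le_norm _ _).trans_eq ?_)
        rw [hnorm, sq]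
      have e : (⟪v - (u : H), v - (u : H)⟫).re = ‖v - (u : H)‖ ^ 2 := by
        rw [inner_self_eq_norm_sq_to_K]; norm_cast
      rw [e]
      exact mul_nonpos_of_nonneg_of_nonpos (by positivity) (by linarith)
    have h6 : v = u := by
      have : ‖v - (u : H)‖ = 0 := by nlinarith [norm_nonneg (v - (u : H))]
      exact sub_eq_zero.1 (norm_eq_zero.1 this)
    have h7 : w = Complex.I • A u := by
      rw [h6, sub_self] at hz
      exact sub_eq_zero.1 hz
    subst h6
    exact ⟨u.2, h7.symm⟩

/-- From `iA - μ = i (A - i(-μ))`, the inverse is `-i` times the resolvent of `A` at `-iμ`. -/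
theorem exists_resolvent_I_smul (hA : IsSymmetricWithRange A) {μ : ℝ} (hμ : μ ≠ 0) :
    ∃ R : H →L[ℂ] H, IsResolvent (Complex.I • A) (μ : ℂ) R ∧ ∀ v, ‖R v‖ ≤ ‖v‖ / |μ| := by
  obtain ⟨Q, ⟨h1, h2⟩, h3⟩ := hA.exists_resolvent (neg_ne_zero.2 hμ)
  have hI : Complex.I * (-Complex.I) = 1 := by simp
  have key : ∀ x y : H, Complex.I • x - (μ : ℂ) • y =
      Complex.I • (x - (((-μ : ℝ) : ℂ) * Complex.I) • y) := fun x y => by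
    rw [smul_sub, smul_smul]
    congr 2
    push_cast
    linear_combination -(μ : ℂ) * hI
  refine ⟨(-Complex.I) • Q, ⟨fun v => ?_, fun u => ?_⟩, fun v => ?_⟩
  · obtain ⟨hv, e⟩ := h1 ((-Complex.I) • v)
    have e0 : ((-Complex.I) • Q) v = Q ((-Complex.I) • v) := by simp
    rw [e0]
    refine ⟨hv, ?_⟩
    rw [LinearPMap.smul_apply, key]
    erw [e]
    rw [smul_smul, hI, one_smul]
  · rw [LinearPMap.smul_apply, key]
    erw [smul_apply, map_smul, h2 u]
    rw [smul_smul, mul_comm, hI, one_smul]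
  · rw [smul_apply, norm_smul, norm_neg, Complex.norm_I, one_mul, ← abs_neg μ]
    exact h3 v

end IsSymmetricWithRange
end Stone

/-! ### Multiplication operators and Fourier multipliers on `L²` -/

section Multipliers

open FourierTransform
open scoped ComplexInnerProductSpace

variable {d : ℕ}

/-- Multiplication by an essentially bounded function, as a bounded operator on `L²`. -/
def mulOp (m : EuclideanSpace ℝ (Fin d) → ℂ) (hm : MemLp m ∞ volume) :
    L2Space d →L[ℂ] L2Space d :=
  (ContinuousLinearMap.mul ℂ ℂ).holderL volume ∞ 2 2 (hm.toLp m)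

theorem coeFn_mulOp {m : EuclideanSpace ℝ (Fin d) → ℂ} (hm : MemLp m ∞ volume) (f : L2Space d) :
    mulOp m hm f =ᵐ[volume] fun x => m x * f x := by
  have h := (ContinuousLinearMap.mul ℂ ℂ).coeFn_holder (r := 2) (hm.toLp m) f
  filter_upwards [h, hm.coeFn_toLp] with x h1 h2
  rw [h2] at h1
  exact h1

theorem norm_le_of_ae_le {f g : L2Space d} {C : ℝ} (h : ∀ᵐ x, ‖f x‖ ≤ C * ‖g x‖) :
    ‖f‖ ≤ C * ‖g‖ :=
  Lp.norm_le_mul_norm_of_ae_le_mul h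

theorem norm_mulOp_apply_le {m : EuclideanSpace ℝ (Fin d) → ℂ} (hm : MemLp m ∞ volume) {C : ℝ}
    (hC : ∀ᵐ x, ‖m x‖ ≤ C) (f : L2Space d) : ‖mulOp m hm f‖ ≤ C * ‖f‖ := by
  refine norm_le_of_ae_le ?_
  filter_upwards [coeFn_mulOp hm f, hC] with x h1 h2
  rw [h1, norm_mul]
  gcongr

theorem inner_mulOp_ofReal {m : EuclideanSpace ℝ (Fin d) → ℝ}
    (hm : MemLp (fun x => (m x : ℂ)) ∞ volume) (f g : L2Space d) :
    ⟪mulOp (fun x => (m x : ℂ)) hm f, g⟫ = ⟪f, mulOp (fun x => (m x : ℂ)) hm g⟫ := by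
  rw [L2.inner_def, L2.inner_def]
  refine integral_congr_ae ?_
  filter_upwards [coeFn_mulOp hm f, coeFn_mulOp hm g] with x h1 h2
  rw [h1, h2]
  simp only [RCLike.inner_apply, map_mul, Complex.conj_ofReal]
  ring

theorem norm_le_of_fourier_le {f g : L2Space d} {C : ℝ}
    (h : ∀ᵐ ξ, ‖𝓕 f ξ‖ ≤ C * ‖𝓕 g ξ‖) : ‖f‖ ≤ C * ‖g‖ := by
  rw [← Lp.norm_fourier_eq f, ← Lp.norm_fourier_eq g]
  exact norm_le_of_ae_le h

theorem ext_fourier {f g : L2Space d}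
    (h : (𝓕 f : L2Space d) =ᵐ[volume] (𝓕 g : L2Space d)) : f = g :=
  (Lp.fourierTransformₗᵢ _ _).injective (Lp.ext h)

/-- The Fourier multiplier with an essentially bounded symbol, as a bounded operator on `L²`. -/
def fourierMul (m : EuclideanSpace ℝ (Fin d) → ℂ) (hm : MemLp m ∞ volume) :
    L2Space d →L[ℂ] L2Space d :=
  ((Lp.fourierTransformₗᵢ (EuclideanSpace ℝ (Fin d)) ℂ).symm.toContinuousLinearEquiv :
      L2Space d →L[ℂ] L2Space d) ∘L mulOp m hm ∘L
    ((Lp.fourierTransformₗᵢ (EuclideanSpace ℝ (Fin d)) ℂ).toContinuousLinearEquiv :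
      L2Space d →L[ℂ] L2Space d)

theorem fourier_fourierMul_eq {m : EuclideanSpace ℝ (Fin d) → ℂ} (hm : MemLp m ∞ volume)
    (f : L2Space d) : 𝓕 (fourierMul m hm f) = mulOp m hm (𝓕 f) :=
  (Lp.fourierTransformₗᵢ (EuclideanSpace ℝ (Fin d)) ℂ).apply_symm_apply _

theorem fourier_fourierMul {m : EuclideanSpace ℝ (Fin d) → ℂ} (hm : MemLp m ∞ volume)
    (f : L2Space d) : (𝓕 (fourierMul m hm f) : L2Space d) =ᵐ[volume] fun ξ => m ξ * 𝓕 f ξ := by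
  rw [fourier_fourierMul_eq]
  exact coeFn_mulOp hm _

theorem memLp_top_of_continuous_of_bound {m : EuclideanSpace ℝ (Fin d) → ℂ} (hm : Continuous m)
    {C : ℝ} (hC : ∀ x, ‖m x‖ ≤ C) : MemLp m ∞ volume :=
  memLp_top_of_bound hm.aestronglyMeasurable C (Eventually.of_forall hC)

/-! ### Distributional identities on the Fourier side -/

/-- Turns distributional identities into pointwise ones. The product `g f` is only locally
integrable a priori, so the forward direction tests against compactly supported functions. -/
theorem toTemperedDistribution_eq_smulLeftCLM_iff {g : EuclideanSpace ℝ (Fin d) → ℂ}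
    (hg : g.HasTemperateGrowth) {f h : L2Space d} :
    (h : 𝓢'(EuclideanSpace ℝ (Fin d), ℂ)) = TemperedDistribution.smulLeftCLM ℂ g
      (f : 𝓢'(EuclideanSpace ℝ (Fin d), ℂ)) ↔ h =ᵐ[volume] fun x => g x * f x := by
  constructor
  · intro he
    have hlf : LocallyIntegrable f volume := (Lp.memLp f).locallyIntegrable (by norm_num)
    have hlh : LocallyIntegrable h volume := (Lp.memLp h).locallyIntegrable (by norm_num)
    have hgf : LocallyIntegrable (fun x => g x * f x) volume := by
      have := hlf.locallyIntegrableOn (s := Set.univ)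
      have h2 := this.continuousOn_mul hg.1.continuous.continuousOn isOpen_univ.isLocallyClosed
      exact locallyIntegrableOn_univ.1 h2
    refine ae_eq_of_integral_contDiff_smul_eq hlh hgf fun ψ hψ hs => ?_
    have hφ : ContDiff ℝ ∞ (fun x => (ψ x : ℂ)) := Complex.ofRealCLM.contDiff.comp hψ
    have hsφ : HasCompactSupport (fun x => (ψ x : ℂ)) :=
      hs.comp_left (g := fun t : ℝ => (t : ℂ)) Complex.ofReal_zero
    have e := congrArg (fun T : 𝓢'(EuclideanSpace ℝ (Fin d), ℂ) => T (hsφ.toSchwartzMap hφ)) he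
    simp only [TemperedDistribution.smulLeftCLM_apply_apply, Lp.toTemperedDistribution_apply,
      SchwartzMap.smulLeftCLM_apply_apply hg, HasCompactSupport.toSchwartzMap_toFun,
      smul_eq_mul] at e
    simp only [Complex.real_smul]
    rw [e]
    congr 1
    ext x
    ring
  · intro he
    ext u
    simp only [TemperedDistribution.smulLeftCLM_apply_apply, Lp.toTemperedDistribution_apply]
    refine integral_congr_ae ?_
    filter_upwards [he] with x hx
    rw [hx, SchwartzMap.smulLeftCLM_apply_apply hg]
    simp only [smul_eq_mul]
    ring

theorem mem_sobolevSpace_iff {s : ℝ} {v : L2Space d} : v ∈ sobolevSpace d s ↔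
    ∃ u : L2Space d, u =ᵐ[volume] fun ξ => (((1 + ‖ξ‖ ^ 2) ^ (s / 2) : ℝ) : ℂ) * 𝓕 v ξ := by
  change TemperedDistribution.MemSobolev s 2 (v : 𝓢'(EuclideanSpace ℝ (Fin d), ℂ)) ↔ _
  rw [TemperedDistribution.memSobolev_iff_exists_smulLeftCLM_fourier]
  refine exists_congr fun u => ?_
  rw [Lp.fourier_toTemperedDistribution_eq, eq_comm,
    toTemperedDistribution_eq_smulLeftCLM_iff (by fun_prop)]

/-- `h = ∂ⱼ f` in the sense of distributions, for `f, h ∈ L²`. -/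
def IsWeakDeriv (j : Fin d) (f h : L2Space d) : Prop :=
  (h : 𝓢'(EuclideanSpace ℝ (Fin d), ℂ)) =
    ∂_{(EuclideanSpace.single j (1 : ℝ) : EuclideanSpace ℝ (Fin d))}
      (f : 𝓢'(EuclideanSpace ℝ (Fin d), ℂ))

/-- The symbol `2πiξⱼ` of `∂ⱼ`. -/
def derivSymbol (j : Fin d) (ξ : EuclideanSpace ℝ (Fin d)) : ℂ := 2 * Real.pi * Complex.I * ξ j

theorem isWeakDeriv_iff_fourier {j : Fin d} {f h : L2Space d} :
    IsWeakDeriv j f h ↔ (𝓕 h : L2Space d) =ᵐ[volume] fun ξ => derivSymbol j ξ * 𝓕 f ξ := by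
  have hg : (fun ξ : EuclideanSpace ℝ (Fin d) =>
      ((inner ℝ ξ (EuclideanSpace.single j (1 : ℝ)) : ℝ) : ℂ)).HasTemperateGrowth := by fun_prop
  have hg' : (derivSymbol j).HasTemperateGrowth := by
    have : derivSymbol j = fun ξ : EuclideanSpace ℝ (Fin d) => (2 * Real.pi * Complex.I : ℂ) *
        ((inner ℝ ξ (EuclideanSpace.single j (1 : ℝ)) : ℝ) : ℂ) := by
      ext ξ
      simp [derivSymbol, EuclideanSpace.inner_single_right]
    rw [this]
    fun_prop
  have hinj : Function.Injective (fun T : 𝓢'(EuclideanSpace ℝ (Fin d), ℂ) => 𝓕 T) :=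
    Function.LeftInverse.injective (g := fun T => 𝓕⁻ T) fun T => fourierInv_fourier_eq T
  rw [IsWeakDeriv, ← hinj.eq_iff]
  beta_reduce
  rw [Lp.fourier_toTemperedDistribution_eq, TemperedDistribution.fourier_lineDerivOp_eq,
    Lp.fourier_toTemperedDistribution_eq, ← toTemperedDistribution_eq_smulLeftCLM_iff hg']
  have : derivSymbol j = (2 * Real.pi * Complex.I : ℂ) • (fun ξ : EuclideanSpace ℝ (Fin d) =>
        ((inner ℝ ξ (EuclideanSpace.single j (1 : ℝ)) : ℝ) : ℂ)) := by
    ext ξ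
    simp [derivSymbol, EuclideanSpace.inner_single_right]
  rw [this, TemperedDistribution.smulLeftCLM_smul hg]
  rfl

theorem isWeakDeriv_iff_integral {j : Fin d} {f h : L2Space d} :
    IsWeakDeriv j f h ↔ ∀ φ : 𝓢(EuclideanSpace ℝ (Fin d), ℂ),
      ∫ x, f x * fderiv ℝ φ x (EuclideanSpace.single j 1) = - ∫ x, h x * φ x := by
  rw [IsWeakDeriv]
  have key : ∀ φ : 𝓢(EuclideanSpace ℝ (Fin d), ℂ),
      (h : 𝓢'(EuclideanSpace ℝ (Fin d), ℂ)) φ =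
        (∂_{(EuclideanSpace.single j (1 : ℝ) : EuclideanSpace ℝ (Fin d))}
          (f : 𝓢'(EuclideanSpace ℝ (Fin d), ℂ))) φ ↔
      ∫ x, f x * fderiv ℝ φ x (EuclideanSpace.single j 1) = - ∫ x, h x * φ x := fun φ => by
    simp only [TemperedDistribution.lineDerivOp_apply_apply, map_neg,
      Lp.toTemperedDistribution_apply, SchwartzMap.lineDerivOp_apply_eq_fderiv, smul_eq_mul,
      mul_comm (φ _), mul_comm (fderiv ℝ _ _ _)]
    rw [eq_comm, neg_eq_iff_eq_neg]
  refine ⟨fun he φ => (key φ).1 (congrArg (fun T : 𝓢'(EuclideanSpace ℝ (Fin d), ℂ) => T φ) he),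
    fun he => ?_⟩
  ext φ
  exact (key φ).2 (he φ)

/-- Distributional derivatives are skew-symmetric. -/
theorem IsWeakDeriv.inner_eq {j : Fin d} {f h f' h' : L2Space d} (H : IsWeakDeriv j f h)
    (H' : IsWeakDeriv j f' h') : ⟪f, h'⟫ = -⟪h, f'⟫ := by
  rw [← Lp.inner_fourier_eq f h', ← Lp.inner_fourier_eq h f', L2.inner_def, L2.inner_def,
    ← integral_neg]
  refine integral_congr_ae ?_
  filter_upwards [isWeakDeriv_iff_fourier.1 H, isWeakDeriv_iff_fourier.1 H'] with ξ h1 h2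
  rw [h1, h2]
  simp only [derivSymbol, RCLike.inner_apply, map_mul, Complex.conj_ofReal, Complex.conj_I,
    map_ofNat]
  ring

theorem schwartz_memLp_top (φ : 𝓢(EuclideanSpace ℝ (Fin d), ℂ)) :
    MemLp (fun x => φ x) ∞ (volume : Measure (EuclideanSpace ℝ (Fin d))) :=
  φ.memLp ∞ volume

theorem L2Space.integrable_mul_schwartz (f : L2Space d)
    (φ : 𝓢(EuclideanSpace ℝ (Fin d), ℂ)) : Integrable (fun x => f x * φ x) volume :=
  (Lp.memLp f).integrable_mul (p := 2) (q := 2) (φ.memLp 2 volume)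

/-- Product rule for the product of an `L²` function and a Schwartz function. -/
theorem IsWeakDeriv.mul_schwartz {j : Fin d} {f h : L2Space d} (H : IsWeakDeriv j f h)
    (φ : 𝓢(EuclideanSpace ℝ (Fin d), ℂ)) :
    IsWeakDeriv j (mulOp (fun x => φ x) (schwartz_memLp_top φ) f)
      (mulOp (fun x => φ x) (schwartz_memLp_top φ) h +
        mulOp (fun x => ∂_{(EuclideanSpace.single j (1 : ℝ) : EuclideanSpace ℝ (Fin d))} φ x)
          (schwartz_memLp_top _) f) := by
  rw [isWeakDeriv_iff_integral]
  intro ψ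
  set e : EuclideanSpace ℝ (Fin d) := EuclideanSpace.single j (1 : ℝ)
  let χ : 𝓢(EuclideanSpace ℝ (Fin d), ℂ) :=
    SchwartzMap.smulLeftCLM ℂ (fun x => φ x) ψ
  have hχ : ∀ x, χ x = φ x * ψ x := fun x => by
    rw [SchwartzMap.smulLeftCLM_apply_apply φ.hasTemperateGrowth, smul_eq_mul]
  have hχ' : ∀ x, fderiv ℝ χ x e = φ x * fderiv ℝ ψ x e + fderiv ℝ φ x e * ψ x := fun x => by
    have h1 : (χ : EuclideanSpace ℝ (Fin d) → ℂ) = fun x => φ x * ψ x := funext hχ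
    rw [h1, fderiv_fun_mul φ.differentiableAt ψ.differentiableAt]
    simp [mul_comm]
  have h1 := isWeakDeriv_iff_integral.1 H χ
  have e1 : ∫ x, mulOp (fun x => φ x) (schwartz_memLp_top φ) f x * fderiv ℝ ψ x e =
      (∫ x, f x * fderiv ℝ χ x e) - ∫ x, f x * (fderiv ℝ φ x e * ψ x) := by
    have i1 : Integrable (fun x => f x * fderiv ℝ χ x e) volume :=
      f.integrable_mul_schwartz (∂_{e} χ)
    have i2 : Integrable (fun x => f x * (fderiv ℝ φ x e * ψ x)) volume := by
      have := f.integrable_mul_schwartz (SchwartzMap.smulLeftCLM ℂ (fun x => (∂_{e} φ) x) ψ)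
      refine this.congr (Eventually.of_forall fun x => ?_)
      simp only
      rw [SchwartzMap.smulLeftCLM_apply_apply (∂_{e} φ).hasTemperateGrowth, smul_eq_mul,
        SchwartzMap.lineDerivOp_apply_eq_fderiv]
    rw [← integral_sub i1 i2]
    refine integral_congr_ae ?_
    filter_upwards [coeFn_mulOp (schwartz_memLp_top φ) f] with x hx
    rw [hx, hχ']
    ring
  have e2 : ∫ x, (mulOp (fun x => φ x) (schwartz_memLp_top φ) h +
        mulOp (fun x => ∂_{e} φ x) (schwartz_memLp_top _) f) x * ψ x =
      (∫ x, h x * χ x) + ∫ x, f x * (fderiv ℝ φ x e * ψ x) := by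
    have i1 : Integrable (fun x => h x * χ x) volume := h.integrable_mul_schwartz χ
    have i2 : Integrable (fun x => f x * (fderiv ℝ φ x e * ψ x)) volume := by
      have := f.integrable_mul_schwartz (SchwartzMap.smulLeftCLM ℂ (fun x => (∂_{e} φ) x) ψ)
      refine this.congr (Eventually.of_forall fun x => ?_)
      simp only
      rw [SchwartzMap.smulLeftCLM_apply_apply (∂_{e} φ).hasTemperateGrowth, smul_eq_mul,
        SchwartzMap.lineDerivOp_apply_eq_fderiv]
    rw [← integral_add i1 i2]
    refine integral_congr_ae ?_
    filter_upwards [coeFn_mulOp (schwartz_memLp_top φ) h,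
      coeFn_mulOp (schwartz_memLp_top (∂_{e} φ)) f, Lp.coeFn_add
        (mulOp (fun x => φ x) (schwartz_memLp_top φ) h)
        (mulOp (fun x => ∂_{e} φ x) (schwartz_memLp_top _) f)] with x h1 h2 h3
    rw [h3, Pi.add_apply, h1, h2, hχ, SchwartzMap.lineDerivOp_apply_eq_fderiv]
    ring
  rw [e1, e2, h1]
  ring

/-- Product rule for a bounded real function `c` with `∂ⱼ c = k ∈ L²`. -/
theorem IsWeakDeriv.mul {j : Fin d} {c : EuclideanSpace ℝ (Fin d) → ℝ}
    (hc : MemLp (fun x => (c x : ℂ)) ∞ volume) (hc2 : MemLp (fun x => (c x : ℂ)) 2 volume)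
    {k f h p : L2Space d} (hk : IsWeakDeriv j (hc2.toLp _) k) (H : IsWeakDeriv j f h)
    (hp : p =ᵐ[volume] fun x => (starRingEnd ℂ) (k x) * f x) :
    IsWeakDeriv j (mulOp (fun x => (c x : ℂ)) hc f) (mulOp (fun x => (c x : ℂ)) hc h + p) := by
  rw [isWeakDeriv_iff_integral]
  intro φ
  set e : EuclideanSpace ℝ (Fin d) := EuclideanSpace.single j (1 : ℝ)
  -- Pairing `c` with `∂ⱼ(φ f) = φ h + (∂ⱼφ) f` gives `-⟪k, φ f⟫`, which is the claim rearranged.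
  -- The conjugate on `k` comes from the inner product and makes it unnecessary to show that `k` is
  -- real.
  have h1 := hk.inner_eq (H.mul_schwartz φ)
  have e1 : ⟪hc2.toLp _, mulOp (fun x => φ x) (schwartz_memLp_top φ) h +
        mulOp (fun x => ∂_{e} φ x) (schwartz_memLp_top _) f⟫ =
      (∫ x, mulOp (fun x => (c x : ℂ)) hc h x * φ x) +
        ∫ x, mulOp (fun x => (c x : ℂ)) hc f x * fderiv ℝ φ x e := by
    have i2 : Integrable (fun x => mulOp (fun x => (c x : ℂ)) hc f x * fderiv ℝ φ x e) volume :=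
      L2Space.integrable_mul_schwartz _ (∂_{e} φ)
    rw [L2.inner_def, ← integral_add (L2Space.integrable_mul_schwartz _ φ) i2]
    refine integral_congr_ae ?_
    filter_upwards [coeFn_mulOp (schwartz_memLp_top φ) h,
      coeFn_mulOp (schwartz_memLp_top (∂_{e} φ)) f, Lp.coeFn_add
        (mulOp (fun x => φ x) (schwartz_memLp_top φ) h)
        (mulOp (fun x => ∂_{e} φ x) (schwartz_memLp_top _) f), coeFn_mulOp hc h, coeFn_mulOp hc f,
        hc2.coeFn_toLp] with x h1 h2 h3 h4 h5 h6
    rw [h3, Pi.add_apply, h1, h2, h4, h5, h6, SchwartzMap.lineDerivOp_apply_eq_fderiv]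
    simp only [RCLike.inner_apply, Complex.conj_ofReal]
    ring
  have e2 : ⟪k, mulOp (fun x => φ x) (schwartz_memLp_top φ) f⟫ = ∫ x, p x * φ x := by
    rw [L2.inner_def]
    refine integral_congr_ae ?_
    filter_upwards [coeFn_mulOp (schwartz_memLp_top φ) f, hp] with x h1 h2
    rw [h1, h2]
    simp only [RCLike.inner_apply]
    ring
  have e3 : ∫ x, (mulOp (fun x => (c x : ℂ)) hc h + p) x * φ x =
      (∫ x, mulOp (fun x => (c x : ℂ)) hc h x * φ x) + ∫ x, p x * φ x := by
    rw [← integral_add (L2Space.integrable_mul_schwartz _ φ) (L2Space.integrable_mul_schwartz _ φ)]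
    refine integral_congr_ae ?_
    filter_upwards [Lp.coeFn_add (mulOp (fun x => (c x : ℂ)) hc h) p] with x h1
    rw [h1, Pi.add_apply]
    ring
  rw [e1, e2] at h1
  rw [e3]
  linear_combination h1

end Multipliers

/-! ### `L^∞` bounds from the Fourier side -/

section SupBound

open FourierTransform
open scoped ComplexInnerProductSpace

variable {d : ℕ}

/-- `f` agrees almost everywhere with the absolutely convergent inverse Fourier integral `g` of its
transform, by duality against test functions. The sign in `-innerₗ` selects the inverse transform.
-/
theorem ae_norm_le_of_integrable_fourier {f : L2Space d}
    (hf : Integrable (𝓕 f : L2Space d) volume) :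
    ∀ᵐ x, ‖f x‖ ≤ ∫ ξ, ‖(𝓕 f : L2Space d) ξ‖ := by
  set F : EuclideanSpace ℝ (Fin d) → ℂ := ⇑(𝓕 f : L2Space d) with hF
  let g : EuclideanSpace ℝ (Fin d) → ℂ := VectorFourier.fourierIntegral Real.fourierChar volume
    (-innerₗ (EuclideanSpace ℝ (Fin d))) F
  have hL : Continuous fun p : EuclideanSpace ℝ (Fin d) × EuclideanSpace ℝ (Fin d) =>
      (-innerₗ (EuclideanSpace ℝ (Fin d))) p.1 p.2 := by
    exact (continuous_inner (𝕜 := ℝ) (E := EuclideanSpace ℝ (Fin d))).neg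
  have hgc : Continuous g :=
    VectorFourier.fourierIntegral_continuous Real.continuous_fourierChar hL hf
  have hgb : ∀ x, ‖g x‖ ≤ ∫ ξ, ‖F ξ‖ := fun x =>
    VectorFourier.norm_fourierIntegral_le_integral_norm _ _ _ _ _
  have hfg : f =ᵐ[volume] g := by
    refine ae_eq_of_integral_contDiff_smul_eq ((Lp.memLp f).locallyIntegrable (by norm_num))
      hgc.locallyIntegrable fun ψ hψ hs => ?_
    have hφ : ContDiff ℝ ∞ (fun x => (ψ x : ℂ)) := Complex.ofRealCLM.contDiff.comp hψ
    have hsφ : HasCompactSupport (fun x => (ψ x : ℂ)) :=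
      hs.comp_left (g := fun t : ℝ => (t : ℂ)) Complex.ofReal_zero
    let φ : 𝓢(EuclideanSpace ℝ (Fin d), ℂ) := hsφ.toSchwartzMap hφ
    have h1 : (f : 𝓢'(EuclideanSpace ℝ (Fin d), ℂ)) = 𝓕⁻ ((𝓕 f : L2Space d) :
        𝓢'(EuclideanSpace ℝ (Fin d), ℂ)) := by
      rw [Lp.fourierInv_toTemperedDistribution_eq, fourierInv_fourier_eq]
    have h2 := congrArg (fun T : 𝓢'(EuclideanSpace ℝ (Fin d), ℂ) => T φ) h1
    simp only [TemperedDistribution.fourierInv_apply, Lp.toTemperedDistribution_apply] at h2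
    have h3 := VectorFourier.integral_fourierIntegral_smul_eq_flip (f := (φ : _ → ℂ)) (g := F)
      (L := -innerₗ (EuclideanSpace ℝ (Fin d))) Real.continuous_fourierChar hL
      (φ.integrable (μ := volume)) hf
    have h4 : (-innerₗ (EuclideanSpace ℝ (Fin d))).flip = -innerₗ (EuclideanSpace ℝ (Fin d)) := by
      ext x y
      simp [real_inner_comm]
    rw [h4] at h3
    have h5 : ∀ ξ, VectorFourier.fourierIntegral Real.fourierChar volume
        (-innerₗ (EuclideanSpace ℝ (Fin d))) φ ξ = (𝓕⁻ φ) ξ := fun ξ => by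
      rw [SchwartzMap.fourierInv_coe]
      rfl
    simp only [h5] at h3
    exact h2.trans h3
  filter_upwards [hfg] with x hx
  rw [hx]
  exact hgb x

/-! ### Japanese bracket, Bessel potentials and sharp frequency cut-offs. -/

/-- The square of the Japanese bracket. -/
def bracketSq (ξ : EuclideanSpace ℝ (Fin d)) : ℝ := 1 + ‖ξ‖ ^ 2

theorem one_le_bracketSq (ξ : EuclideanSpace ℝ (Fin d)) : 1 ≤ bracketSq ξ := by
  simp only [bracketSq]; nlinarith [sq_nonneg ‖ξ‖]

theorem bracketSq_pos (ξ : EuclideanSpace ℝ (Fin d)) : 0 < bracketSq ξ :=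
  one_pos.trans_le (one_le_bracketSq ξ)

theorem continuous_bracketSq : Continuous (bracketSq (d := d)) := by
  unfold bracketSq; fun_prop

theorem continuous_bracketSq_rpow (s : ℝ) : Continuous fun ξ => bracketSq (d := d) ξ ^ s :=
  continuous_bracketSq.rpow_const fun ξ => Or.inl (bracketSq_pos ξ).ne'

theorem memLp_bracketSq_rpow {s : ℝ} (hs : (d : ℝ) < 2 * s) :
    MemLp (fun ξ => bracketSq (d := d) ξ ^ (-s / 2)) 2 volume := by
  refine (memLp_two_iff_integrable_sq
    (continuous_bracketSq_rpow (-s / 2)).aestronglyMeasurable).2 ?_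
  have h := integrable_rpow_neg_one_add_norm_sq (E := EuclideanSpace ℝ (Fin d))
    (μ := volume) (r := 2 * s) (by simpa using hs)
  refine h.congr (Eventually.of_forall fun ξ => ?_)
  simp only
  rw [← Real.rpow_mul_natCast (bracketSq_pos ξ).le, bracketSq]
  congr 1
  push_cast
  ring

/-- If `f̂` is dominated by `⟨ξ⟩^{-s} |u|` with `u ∈ L²`, `s > d/2`, then `f` is bounded. -/
theorem exists_ae_norm_le {s : ℝ} (hs : (d : ℝ) < 2 * s) :
    ∃ W : ℝ, 0 ≤ W ∧ ∀ (f u : L2Space d) (C : ℝ), 0 ≤ C →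
      (∀ᵐ ξ, ‖(𝓕 f : L2Space d) ξ‖ ≤ C * (bracketSq ξ ^ (-s / 2) * ‖u ξ‖)) →
      ∀ᵐ x, ‖f x‖ ≤ C * (W * ‖u‖) := by
  have hw := memLp_bracketSq_rpow hs
  let w : Lp ℝ 2 (volume : Measure (EuclideanSpace ℝ (Fin d))) := hw.toLp _
  refine ⟨‖w‖, norm_nonneg _, fun f u C hC h => ?_⟩
  let un : Lp ℝ 2 (volume : Measure (EuclideanSpace ℝ (Fin d))) := (Lp.memLp u).norm.toLp _
  have hun : ‖un‖ = ‖u‖ := by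
    simp only [un, Lp.norm_toLp, eLpNorm_norm]
    rfl
  have hi : Integrable (fun ξ => bracketSq ξ ^ (-s / 2) * ‖u ξ‖) volume :=
    hw.integrable_mul (p := 2) (q := 2) (Lp.memLp u).norm
  have hle : ∫ ξ, bracketSq ξ ^ (-s / 2) * ‖u ξ‖ ≤ ‖w‖ * ‖u‖ := by
    rw [← hun]
    refine le_trans (le_of_eq ?_) (real_inner_le_norm w un)
    rw [L2.inner_def]
    refine integral_congr_ae ?_
    filter_upwards [hw.coeFn_toLp, (Lp.memLp u).norm.coeFn_toLp] with ξ h1 h2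
    simp only [w, un]
    rw [h1, h2]
    simp [mul_comm]
  have hF : Integrable (𝓕 f : L2Space d) volume :=
    (hi.const_mul C).mono' (Lp.aestronglyMeasurable _) h
  filter_upwards [ae_norm_le_of_integrable_fourier hF] with x hx
  refine hx.trans ?_
  calc ∫ ξ, ‖(𝓕 f : L2Space d) ξ‖ ≤ ∫ ξ, C * (bracketSq ξ ^ (-s / 2) * ‖u ξ‖) :=
        integral_mono_ae hF.norm (hi.const_mul C) h
    _ = C * ∫ ξ, bracketSq ξ ^ (-s / 2) * ‖u ξ‖ := integral_const_mul _ _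
    _ ≤ C * (‖w‖ * ‖u‖) := by gcongr

/-- On frequencies with `⟨ξ⟩² ≤ L`, extra decay of order `a` costs a factor `L ^ a`. This converts
`L²` information into sup bounds. -/
theorem rpow_le_of_le {w L a s : ℝ} (hw : 0 < w) (hwL : w ≤ L) (ha : 0 ≤ a) :
    w ^ (-s) ≤ L ^ a * w ^ (-(s + a)) := by
  have h : w ^ (-s) = w ^ a * w ^ (-(s + a)) := by
    rw [← Real.rpow_add hw]; congr 1; ring
  rw [h]
  gcongr

theorem memLp_bracketSq_neg {s : ℝ} (hs : 0 ≤ s) :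
    MemLp (fun ξ => ((bracketSq (d := d) ξ ^ (-s) : ℝ) : ℂ)) ∞ volume := by
  refine memLp_top_of_continuous_of_bound
    (Complex.continuous_ofReal.comp (continuous_bracketSq_rpow _)) (C := 1) fun ξ => ?_
  rw [Complex.norm_real, Real.norm_of_nonneg (Real.rpow_nonneg (bracketSq_pos ξ).le _)]
  exact Real.rpow_le_one_of_one_le_of_nonpos (one_le_bracketSq ξ) (by linarith)

/-- The operator `⟨D⟩^{-2s}` on `L²`, `s ≥ 0`. -/
def besselOp (d : ℕ) (s : ℝ) (hs : 0 ≤ s) : L2Space d →L[ℂ] L2Space d :=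
  fourierMul (fun ξ => ((bracketSq (d := d) ξ ^ (-s) : ℝ) : ℂ)) (memLp_bracketSq_neg hs)

theorem norm_fourier_besselOp {s : ℝ} (hs : 0 ≤ s) (u : L2Space d) :
    ∀ᵐ ξ, ‖(𝓕 (besselOp d s hs u) : L2Space d) ξ‖ =
      bracketSq ξ ^ (-s) * ‖(𝓕 u : L2Space d) ξ‖ := by
  filter_upwards [fourier_fourierMul (memLp_bracketSq_neg hs) u] with ξ h
  rw [besselOp, h, norm_mul, Complex.norm_real,
    Real.norm_of_nonneg (Real.rpow_nonneg (bracketSq_pos ξ).le _)]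

/-- The symbol of the sharp frequency cut-off to `⟨ξ⟩² ≤ L`. -/
def cutoff (L : ℝ) (ξ : EuclideanSpace ℝ (Fin d)) : ℂ := if bracketSq ξ ≤ L then 1 else 0

theorem memLp_cutoff (L : ℝ) : MemLp (cutoff (d := d) L) ∞ volume := by
  refine memLp_top_of_bound (Measurable.aestronglyMeasurable ?_) 1
    (Eventually.of_forall fun ξ => ?_)
  · exact Measurable.ite (measurableSet_le continuous_bracketSq.measurable measurable_const)
      measurable_const measurable_const
  · unfold cutoff
    split_ifs <;> simp

/-- The sharp frequency cut-off to `⟨ξ⟩² ≤ L`. -/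
def lowPass (d : ℕ) (L : ℝ) : L2Space d →L[ℂ] L2Space d := fourierMul (cutoff L) (memLp_cutoff L)

theorem fourier_lowPass (L : ℝ) (f : L2Space d) : (𝓕 (lowPass d L f) : L2Space d) =ᵐ[volume]
    fun ξ => cutoff L ξ * (𝓕 f : L2Space d) ξ :=
  fourier_fourierMul _ _

theorem fourier_sub (f g : L2Space d) : (𝓕 (f - g) : L2Space d) = 𝓕 f - 𝓕 g :=
  (Lp.fourierTransformₗᵢ (EuclideanSpace ℝ (Fin d)) ℂ).map_sub f g

theorem fourier_sub_lowPass (L : ℝ) (f : L2Space d) :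
    (𝓕 (f - lowPass d L f) : L2Space d) =ᵐ[volume]
      fun ξ => (1 - cutoff L ξ) * (𝓕 f : L2Space d) ξ := by
  rw [fourier_sub]
  filter_upwards [Lp.coeFn_sub (𝓕 f : L2Space d) (𝓕 (lowPass d L f)), fourier_lowPass L f]
    with ξ h1 h2
  rw [h1, Pi.sub_apply, h2]
  ring

end SupBound

/-! ### Multiplication by a function in `Hʳ` maps `H¹` to `L²` -/

section ProductEstimate

open FourierTransform

variable {d : ℕ}

theorem memLp_top_conj {k : L2Space d} {B : ℝ} (hB : ∀ᵐ x, ‖k x‖ ≤ B) :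
    MemLp (fun x => (starRingEnd ℂ) (k x)) ∞ volume := by
  refine memLp_top_of_bound
    (Complex.continuous_conj.comp_aestronglyMeasurable (Lp.aestronglyMeasurable k)) B ?_
  filter_upwards [hB] with x hx
  rwa [RCLike.norm_conj]

/-- Estimate of `k̄ g`, `k` frequency-localized at `⟨ξ⟩² ∼ L`, by splitting `g` at `L`. -/
theorem exists_norm_mul_localized_le (hd : d ≤ 2) {r : ℝ} (hr₀ : 0 < r) (hr₁ : r < 1) :
    ∃ W : ℝ, 0 ≤ W ∧ ∀ (k U : L2Space d) (L : ℝ), 1 ≤ L →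
      (∀ᵐ ξ, ‖(𝓕 k : L2Space d) ξ‖ ≤
        if L < bracketSq ξ ∧ bracketSq ξ ≤ 4 * L then bracketSq ξ ^ (-(r / 2)) * ‖U ξ‖ else 0) →
      ∃ B : ℝ, ∃ hB : ∀ᵐ x, ‖k x‖ ≤ B, ∀ u : L2Space d,
        ‖mulOp _ (memLp_top_conj hB) (besselOp d (1 / 2) (by norm_num) u)‖ ≤
          W * ‖U‖ * L ^ (-(r / 4)) * ‖u‖ := by
  have hd' : (d : ℝ) ≤ 2 := by exact_mod_cast hd
  -- This `s` exceeds `d/2`. For `g ∈ H¹` its excess over `1` costs `L ^ (r/4)` on low frequencies,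
  -- half of the gain `L ^ (-r/2)` in `‖k‖`.
  obtain ⟨W, hW0, hW⟩ := exists_ae_norm_le (d := d) (s := 1 + r / 2) (by linarith)
  -- Low frequencies of `g` (sup norm, times `‖k‖₂`) contribute `1`; high frequencies (`L²` norm,
  -- times `sup |k|`) contribute `4 ≥ 4 ^ (1/2 - r/4)`.
  refine ⟨5 * W, by positivity, fun k U L hL hk => ?_⟩
  have hL0 : 0 < L := one_pos.trans_le hL
  have hkB : ∀ᵐ x, ‖k x‖ ≤ (4 * L) ^ (1 / 2 - r / 4) * (W * ‖U‖) := by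
    refine hW k U _ (by positivity) ?_
    filter_upwards [hk] with ξ h
    refine h.trans ?_
    have hp := bracketSq_pos ξ
    split_ifs with hc
    · rw [← mul_assoc]
      gcongr
      refine (rpow_le_of_le (a := 1 / 2 - r / 4) hp hc.2 (by linarith)).trans_eq ?_
      congr 2
      ring
    · positivity
  have hk2 : ‖k‖ ≤ L ^ (-(r / 2)) * ‖U‖ := by
    rw [← Lp.norm_fourier_eq]
    refine norm_le_of_ae_le ?_
    filter_upwards [hk] with ξ h
    refine h.trans ?_
    split_ifs with hc
    · gcongr ?_ * _
      exact Real.rpow_le_rpow_of_nonpos hL0 hc.1.le (by linarith)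
    · positivity
  refine ⟨_, hkB, fun u => ?_⟩
  set g := besselOp d (1 / 2) (by norm_num) u with hg
  have hgF := norm_fourier_besselOp (d := d) (s := 1 / 2) (by norm_num) u
  have hlow : ∀ᵐ x, ‖lowPass d L g x‖ ≤ L ^ (r / 4) * (W * ‖(𝓕 u : L2Space d)‖) := by
    refine hW _ _ _ (by positivity) ?_
    filter_upwards [fourier_lowPass L g, hgF] with ξ h1 h2
    have hp := bracketSq_pos ξ
    rw [h1, norm_mul, h2, cutoff]
    split_ifs with hc
    · rw [norm_one, one_mul, ← mul_assoc]
      gcongr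
      refine (rpow_le_of_le (a := r / 4) hp hc (by linarith)).trans_eq ?_
      congr 2
      ring
    · rw [norm_zero, zero_mul]
      positivity
  have hhigh : ‖g - lowPass d L g‖ ≤ L ^ (-(1 / 2) : ℝ) * ‖u‖ := by
    refine norm_le_of_fourier_le ?_
    filter_upwards [fourier_sub_lowPass L g, hgF] with ξ h1 h2
    rw [h1, norm_mul, h2, cutoff]
    split_ifs with hc
    · rw [sub_self, norm_zero, zero_mul]
      positivity
    · rw [sub_zero, norm_one, one_mul]
      gcongr ?_ * _
      exact Real.rpow_le_rpow_of_nonpos hL0 (not_le.1 hc).le (by norm_num)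
  rw [Lp.norm_fourier_eq] at hlow
  have e : g = lowPass d L g + (g - lowPass d L g) := by abel
  rw [e, map_add]
  refine (norm_add_le _ _).trans ?_
  have b1 : ‖mulOp _ (memLp_top_conj hkB) (lowPass d L g)‖ ≤
      L ^ (r / 4) * (W * ‖u‖) * (L ^ (-(r / 2)) * ‖U‖) := by
    refine le_trans (norm_le_of_ae_le (g := k) (C := L ^ (r / 4) * (W * ‖u‖)) ?_)
      (by gcongr)
    filter_upwards [coeFn_mulOp (memLp_top_conj hkB) (lowPass d L g), hlow] with x h1 h2
    rw [h1, norm_mul, RCLike.norm_conj, mul_comm]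
    gcongr
  have b2 : ‖mulOp _ (memLp_top_conj hkB) (g - lowPass d L g)‖ ≤
      (4 * L) ^ (1 / 2 - r / 4) * (W * ‖U‖) * (L ^ (-(1 / 2) : ℝ) * ‖u‖) := by
    refine (norm_mulOp_apply_le _ (C := (4 * L) ^ (1 / 2 - r / 4) * (W * ‖U‖)) ?_ _).trans
      (by gcongr)
    filter_upwards [hkB] with x hx
    rwa [RCLike.norm_conj]
  have e1 : L ^ (r / 4) * L ^ (-(r / 2)) = L ^ (-(r / 4)) := by
    rw [← Real.rpow_add hL0]; congr 1; ring
  have e2 : (4 * L) ^ (1 / 2 - r / 4) * L ^ (-(1 / 2) : ℝ) ≤ 4 * L ^ (-(r / 4)) := by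
    rw [Real.mul_rpow (by norm_num) hL0.le, mul_assoc, ← Real.rpow_add hL0]
    have : (4 : ℝ) ^ (1 / 2 - r / 4) ≤ 4 ^ (1 : ℝ) :=
      Real.rpow_le_rpow_of_exponent_le (by norm_num) (by linarith)
    rw [Real.rpow_one] at this
    have e3 : 1 / 2 - r / 4 + -(1 / 2) = -(r / 4) := by ring
    rw [e3]
    gcongr
  calc _ ≤ L ^ (r / 4) * (W * ‖u‖) * (L ^ (-(r / 2)) * ‖U‖) +
        (4 * L) ^ (1 / 2 - r / 4) * (W * ‖U‖) * (L ^ (-(1 / 2) : ℝ) * ‖u‖) := add_le_add b1 b2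
    _ = (L ^ (r / 4) * L ^ (-(r / 2)) + (4 * L) ^ (1 / 2 - r / 4) * L ^ (-(1 / 2) : ℝ)) *
        (W * ‖U‖ * ‖u‖) := by ring
    _ ≤ (L ^ (-(r / 4)) + 4 * L ^ (-(r / 4))) * (W * ‖U‖ * ‖u‖) := by
        rw [e1]; gcongr
    _ = _ := by ring

end ProductEstimate

/-! ### Summation of the dyadic pieces of the multiplier. -/

section ProductOperator

open FourierTransform

variable {d : ℕ}

theorem fourier_localized {r : ℝ} {k U : L2Space d}
    (hU : ∀ᵐ ξ, ‖(𝓕 k : L2Space d) ξ‖ = bracketSq ξ ^ (-(r / 2)) * ‖U ξ‖) (L : ℝ) :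
    ∀ᵐ ξ, ‖(𝓕 (lowPass d (4 * L) k - lowPass d L k) : L2Space d) ξ‖ ≤
      if L < bracketSq ξ ∧ bracketSq ξ ≤ 4 * L then bracketSq ξ ^ (-(r / 2)) * ‖U ξ‖ else 0 := by
  rw [fourier_sub]
  filter_upwards [hU, fourier_lowPass L k, fourier_lowPass (4 * L) k,
    Lp.coeFn_sub (𝓕 (lowPass d (4 * L) k) : L2Space d) (𝓕 (lowPass d L k))] with ξ h1 h2 h3 h4
  have hp := one_le_bracketSq ξ
  rw [h4, Pi.sub_apply, h2, h3, ← sub_mul, norm_mul, h1, cutoff, cutoff]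
  by_cases ha : bracketSq ξ ≤ L
  · have hb : bracketSq ξ ≤ 4 * L := by linarith
    rw [if_pos ha, if_pos hb, if_neg (by simp [ha])]
    simp
  · by_cases hb : bracketSq ξ ≤ 4 * L
    · rw [if_neg ha, if_pos hb, if_pos ⟨not_le.1 ha, hb⟩]
      simp
    · rw [if_neg ha, if_neg hb, if_neg (by simp [hb])]
      simp

theorem norm_sub_lowPass_le {r : ℝ} (hr : 0 ≤ r) {k U : L2Space d}
    (hU : ∀ᵐ ξ, ‖(𝓕 k : L2Space d) ξ‖ = bracketSq ξ ^ (-(r / 2)) * ‖U ξ‖) {L : ℝ} (hL : 0 < L) :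
    ‖k - lowPass d L k‖ ≤ L ^ (-(r / 2)) * ‖U‖ := by
  rw [← Lp.norm_fourier_eq]
  refine norm_le_of_ae_le ?_
  filter_upwards [hU, fourier_sub_lowPass L k] with ξ h1 h2
  rw [h2, norm_mul, h1, cutoff]
  split_ifs with hc
  · rw [sub_self, norm_zero, zero_mul]
    positivity
  · rw [sub_zero, norm_one, one_mul]
    gcongr ?_ * _
    exact Real.rpow_le_rpow_of_nonpos hL (not_le.1 hc).le (by linarith)

theorem exists_norm_lowPass_le (hd : d ≤ 2) {r : ℝ} (hr₀ : 0 < r) (hr₁ : r < 1) {k U : L2Space d}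
    (hU : ∀ᵐ ξ, ‖(𝓕 k : L2Space d) ξ‖ = bracketSq ξ ^ (-(r / 2)) * ‖U ξ‖) {L : ℝ} (hL : 0 < L) :
    ∃ B : ℝ, ∀ᵐ x, ‖lowPass d L k x‖ ≤ B := by
  have hd' : (d : ℝ) ≤ 2 := by exact_mod_cast hd
  obtain ⟨W, hW0, hW⟩ := exists_ae_norm_le (d := d) (s := 1 + r / 2) (by linarith)
  refine ⟨_, hW _ U (L ^ (1 / 2 - r / 4)) (by positivity) ?_⟩
  filter_upwards [hU, fourier_lowPass L k] with ξ h1 h2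
  have hp := bracketSq_pos ξ
  rw [h2, norm_mul, h1, cutoff]
  split_ifs with hc
  · rw [norm_one, one_mul, ← mul_assoc]
    gcongr
    refine (rpow_le_of_le (a := 1 / 2 - r / 4) hp hc (by linarith)).trans_eq ?_
    congr 2
    ring
  · rw [norm_zero, zero_mul]
    positivity

/-- For `k ∈ Hʳ(ℝᵈ)`, `r > 0`, `d ≤ 2`, multiplication by `k̄` maps `H¹` to `L²`, and is
infinitesimally bounded with respect to the `H¹` norm. -/
theorem exists_productOp (hd : d ≤ 2) {r : ℝ} (hr₀ : 0 < r) (hr₁ : r < 1) {k U : L2Space d}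
    (hU : ∀ᵐ ξ, ‖(𝓕 k : L2Space d) ξ‖ = bracketSq ξ ^ (-(r / 2)) * ‖U ξ‖) :
    ∃ Q : L2Space d →L[ℂ] L2Space d,
      (∀ u, Q u =ᵐ[volume] fun x => (starRingEnd ℂ) (k x) *
        besselOp d (1 / 2) (by norm_num) u x) ∧
      ∀ δ > 0, ∃ C, 0 ≤ C ∧ ∀ u, ‖Q u‖ ≤ δ * ‖u‖ + C * ‖besselOp d (1 / 2) (by norm_num) u‖ := by
  set J := besselOp d (1 / 2) (by norm_num) with hJ
  have hL : ∀ N : ℕ, (0 : ℝ) < 4 ^ N := fun N => by positivity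
  have hL1 : ∀ N : ℕ, (1 : ℝ) ≤ 4 ^ N := fun N => one_le_pow₀ (by norm_num)
  choose B hB using fun N : ℕ => exists_norm_lowPass_le hd hr₀ hr₁ hU (hL N)
  let M : ℕ → L2Space d →L[ℂ] L2Space d := fun N => mulOp _ (memLp_top_conj (hB N))
  let S : ℕ → L2Space d →L[ℂ] L2Space d := fun N => M N ∘L J
  have hS : ∀ N u, S N u =ᵐ[volume] fun x => (starRingEnd ℂ) (lowPass d (4 ^ N) k x) * J u x :=
    fun N u => coeFn_mulOp (memLp_top_conj (hB N)) (J u)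
  obtain ⟨W, hW0, hW⟩ := exists_norm_mul_localized_le hd hr₀ hr₁
  set ρ : ℝ := 4 ^ (-(r / 4)) with hρ
  have hρ0 : 0 < ρ := by positivity
  have hρ1 : ρ < 1 := Real.rpow_lt_one_of_one_lt_of_neg (by norm_num) (by linarith)
  have hρN : ∀ N : ℕ, ((4 : ℝ) ^ N) ^ (-(r / 4)) = ρ ^ N := fun N => by
    rw [hρ, ← Real.rpow_natCast, ← Real.rpow_natCast, ← Real.rpow_mul (by norm_num),
      ← Real.rpow_mul (by norm_num), mul_comm]
  -- Consecutive operators differ by one dyadic block of `k`, so the localized estimate makes the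
  -- sequence geometric in operator norm.
  have hdist : ∀ N, dist (S N) (S (N + 1)) ≤ W * ‖U‖ * ρ ^ N := fun N => by
    rw [dist_comm, dist_eq_norm]
    refine ContinuousLinearMap.opNorm_le_bound _ (by positivity) fun u => ?_
    obtain ⟨B', hB', h⟩ := hW _ U (4 ^ N) (hL1 N) (fourier_localized hU (4 ^ N))
    have h2 := h u
    rw [hρN] at h2
    refine le_of_eq_of_le ?_ h2
    congr 1
    refine Lp.ext ?_
    have e4 : (4 : ℝ) ^ (N + 1) = 4 * 4 ^ N := by ring
    have hS1 := hS (N + 1) u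
    rw [e4] at hS1
    filter_upwards [hS N u, hS1, Lp.coeFn_sub (S (N + 1) u) (S N u),
      coeFn_mulOp (memLp_top_conj hB') (J u),
      Lp.coeFn_sub (lowPass d (4 * 4 ^ N) k) (lowPass d (4 ^ N) k)] with x h1 h2 h3 h4 h5
    rw [h4, sub_apply, h3, Pi.sub_apply, h1, h2, h5, Pi.sub_apply, map_sub, sub_mul]
  have hcauchy : CauchySeq S := cauchySeq_of_le_geometric ρ _ hρ1 hdist
  obtain ⟨Q, hQ⟩ := cauchySeq_tendsto_of_complete hcauchy
  have hQdist := dist_le_of_le_geometric_of_tendsto ρ _ hρ1 hdist hQ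
  refine ⟨Q, fun u => ?_, fun δ hδ => ?_⟩
  · have hQu : Tendsto (fun N => S N u) atTop (𝓝 (Q u)) :=
      ((ContinuousLinearMap.apply ℂ (L2Space d) u).continuous.tendsto Q).comp hQ
    have hk : Tendsto (fun N : ℕ => lowPass d (4 ^ N) k) atTop (𝓝 k) := by
      rw [tendsto_iff_norm_sub_tendsto_zero]
      have h0 : Tendsto (fun N : ℕ => ((4 : ℝ) ^ N) ^ (-(r / 2)) * ‖U‖) atTop (𝓝 0) := by
        have h1 := (tendsto_rpow_neg_atTop (y := r / 2) (by linarith)).comp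
          (tendsto_pow_atTop_atTop_of_one_lt (r := (4 : ℝ)) (by norm_num))
        simpa using h1.mul_const ‖U‖
      refine squeeze_zero (fun _ => norm_nonneg _) (fun N => ?_) h0
      rw [norm_sub_rev]
      exact norm_sub_lowPass_le hr₀.le hU (hL N)
    -- The norm limit `Q u` is identified pointwise along a common subsequence on which both
    -- `lowPass` of `k` and `S N u` converge almost everywhere.
    obtain ⟨ns, hns, h1⟩ := (tendstoInMeasure_of_tendsto_Lp hk).exists_seq_tendsto_ae
    obtain ⟨ms, hms, h2⟩ :=
      (tendstoInMeasure_of_tendsto_Lp (hQu.comp hns.tendsto_atTop)).exists_seq_tendsto_ae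
    have h3 : ∀ᵐ x, ∀ N, S N u x = (starRingEnd ℂ) (lowPass d (4 ^ N) k x) * J u x :=
      ae_all_iff.2 fun N => hS N u
    filter_upwards [h1, h2, h3] with x a1 a2 a3
    refine tendsto_nhds_unique a2 ?_
    simp only [Function.comp_apply, a3]
    exact ((Complex.continuous_conj.tendsto _).comp
      (a1.comp hms.tendsto_atTop)).mul_const _
  · have h0 : Tendsto (fun N : ℕ => W * ‖U‖ * ρ ^ N / (1 - ρ)) atTop (𝓝 0) := by
      simpa using ((tendsto_pow_atTop_nhds_zero_of_lt_one hρ0.le hρ1).const_mul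
        (W * ‖U‖)).div_const (1 - ρ)
    obtain ⟨N, hN⟩ := (h0.eventually_le_const hδ).exists
    refine ⟨‖M N‖, norm_nonneg _, fun u => ?_⟩
    -- The tail is below `δ` in operator norm; `S N` is multiplication by a bounded function after
    -- `J`, so it only costs `‖J u‖`.
    have e : Q u = (Q - S N) u + M N (J u) := by
      simp [S]
    rw [e]
    refine (norm_add_le _ _).trans (add_le_add ?_ ((M N).le_opNorm _))
    refine ((Q - S N).le_opNorm u).trans ?_
    gcongr
    rw [← dist_eq_norm, dist_comm]
    exact (hQdist N).trans hN

end ProductOperator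

/-! ### The method of continuity -/

section Continuity

variable {H : Type*} [NormedAddCommGroup H] [NormedSpace ℂ H] [CompleteSpace H]

/-- The lower bound gives `‖S⁻¹‖ ≤ 1/κ`, so `T = S (1 - S⁻¹ (S - T))` is inverted by a Neumann
series. -/
theorem isUnit_of_norm_sub_lt {S T : H →L[ℂ] H} {κ : ℝ} (hκ : 0 < κ)
    (hS : ∀ u, κ * ‖u‖ ≤ ‖S u‖) (hu : IsUnit S) (hST : ‖S - T‖ < κ) : IsUnit T := by
  obtain ⟨U, rfl⟩ := hu
  have hinv : ‖(↑U⁻¹ : H →L[ℂ] H)‖ ≤ κ⁻¹ := by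
    refine ContinuousLinearMap.opNorm_le_bound _ (by positivity) fun y => ?_
    have h1 := hS ((↑U⁻¹ : H →L[ℂ] H) y)
    rw [← mul_apply_eq_comp, Units.mul_inv, one_apply_eq_self] at h1
    rwa [le_inv_mul_iff₀ hκ]
  have h1 : ‖(↑U⁻¹ : H →L[ℂ] H) * (U - T)‖ < 1 := by
    refine (norm_mul_le _ _).trans_lt ?_
    calc _ ≤ κ⁻¹ * ‖(U : H →L[ℂ] H) - T‖ := by gcongr
      _ < κ⁻¹ * κ := by gcongr
      _ = 1 := inv_mul_cancel₀ hκ.ne'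
  have e : T = U * (1 - (↑U⁻¹ : H →L[ℂ] H) * (U - T)) := by
    rw [mul_sub, mul_one, ← mul_assoc, Units.mul_inv, one_mul, sub_sub_cancel]
  rw [e]
  exact U.isUnit.mul (isUnit_one_sub_of_norm_lt_one h1)

/-- As `κ` is uniform in `t`, invertibility propagates from `0` to `1` in `N` equal steps, where
`‖T‖ / N < κ`. -/
theorem surjective_of_continuity {S T : H →L[ℂ] H} {κ : ℝ} (hκ : 0 < κ)
    (hb : ∀ t : ℝ, 0 ≤ t → t ≤ 1 → ∀ u, κ * ‖u‖ ≤ ‖(S + t • T) u‖)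
    (hS : Function.Surjective S) : Function.Surjective (S + T) := by
  have h0 : IsUnit S := by
    refine ContinuousLinearMap.isUnit_iff_bijective.2 ⟨?_, hS⟩
    refine (injective_iff_map_eq_zero S).2 fun u hu => ?_
    have h1 := hb 0 le_rfl zero_le_one u
    rw [zero_smul, add_zero, hu, norm_zero] at h1
    have h2 : ‖u‖ = 0 := by nlinarith [norm_nonneg u]
    exact norm_eq_zero.1 h2
  obtain ⟨N, hN⟩ := exists_nat_gt (‖T‖ / κ)
  have hN0 : (0 : ℝ) < N := lt_of_le_of_lt (by positivity) hN
  have key : ∀ n : ℕ, n ≤ N → IsUnit (S + ((n : ℝ) / N) • T) := by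
    intro n
    induction n with
    | zero => intro _; simpa using h0
    | succ n ih =>
      intro hn
      have hn' : (n : ℝ) ≤ N := by exact_mod_cast (Nat.le_of_succ_le hn)
      refine isUnit_of_norm_sub_lt hκ (hb (n / N) (by positivity) ?_) (ih (by omega)) ?_
      · rwa [div_le_one hN0]
      · have e : S + ((n : ℝ) / N) • T - (S + (((n + 1 : ℕ) : ℝ) / N) • T) = -((N : ℝ)⁻¹ • T) := by
          rw [add_sub_add_left_eq_sub, ← sub_smul, ← neg_smul]
          congr 1
          push_cast
          field_simp
          ring
        rw [e, norm_neg, norm_smul, norm_inv, Real.norm_of_nonneg hN0.le, inv_mul_lt_iff₀ hN0]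
        rwa [div_lt_iff₀ hκ] at hN
  have h1 := key N le_rfl
  rw [div_self hN0.ne', one_smul] at h1
  exact (ContinuousLinearMap.isUnit_iff_bijective.1 h1).2

end Continuity

/-! ### The divergence form operator on the Fourier side -/

section Symbols

open FourierTransform
open scoped ComplexInnerProductSpace

variable {d : ℕ}

/-- The symbol `2πiξⱼ / ⟨ξ⟩` of `∂ⱼ ⟨D⟩⁻¹`. -/
def rieszSymbol (j : Fin d) (ξ : EuclideanSpace ℝ (Fin d)) : ℂ :=
  derivSymbol j ξ * ((bracketSq ξ ^ (-(1 / 2) : ℝ) : ℝ) : ℂ)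

theorem norm_rieszSymbol_le (j : Fin d) (ξ : EuclideanSpace ℝ (Fin d)) :
    ‖rieszSymbol j ξ‖ ≤ 2 * Real.pi := by
  have hp := bracketSq_pos ξ
  have h1 : |ξ j| ≤ bracketSq ξ ^ (1 / 2 : ℝ) := by
    rw [← Real.sqrt_eq_rpow]
    refine (PiLp.norm_apply_le ξ j).trans (Real.le_sqrt_of_sq_le ?_)
    simp [bracketSq]
  rw [rieszSymbol, derivSymbol, norm_mul, norm_mul, norm_mul, norm_mul, Complex.norm_I,
    Complex.norm_real, Complex.norm_real, Complex.norm_real, Real.norm_of_nonneg Real.pi_pos.le,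
    Real.norm_of_nonneg (Real.rpow_nonneg hp.le _), Real.rpow_neg hp.le, Real.norm_eq_abs]
  have h2 : |ξ j| * (bracketSq ξ ^ (1 / 2 : ℝ))⁻¹ ≤ 1 := by
    rw [← div_eq_mul_inv]
    exact div_le_one_of_le₀ h1 (by positivity)
  have h3 : ‖(2 : ℂ)‖ = 2 := by simp
  rw [h3]
  nlinarith [Real.pi_pos]

theorem memLp_rieszSymbol (j : Fin d) : MemLp (rieszSymbol j) ∞ volume := by
  refine memLp_top_of_continuous_of_bound ?_ (norm_rieszSymbol_le j)
  have := continuous_bracketSq_rpow (d := d) (-(1 / 2))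
  unfold rieszSymbol derivSymbol
  fun_prop

/-- The operator `∂ⱼ ⟨D⟩⁻¹` on `L²`. -/
def rieszOp (j : Fin d) : L2Space d →L[ℂ] L2Space d :=
  fourierMul (rieszSymbol j) (memLp_rieszSymbol j)

theorem fourier_rieszOp (j : Fin d) (u : L2Space d) :
    (𝓕 (rieszOp j u) : L2Space d) =ᵐ[volume] fun ξ => rieszSymbol j ξ * (𝓕 u : L2Space d) ξ :=
  fourier_fourierMul _ _

theorem norm_rieszOp_le (j : Fin d) (u : L2Space d) : ‖rieszOp j u‖ ≤ 2 * Real.pi * ‖u‖ := by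
  refine norm_le_of_fourier_le ?_
  filter_upwards [fourier_rieszOp j u] with ξ h
  rw [h, norm_mul]
  gcongr
  exact norm_rieszSymbol_le j ξ

theorem fourier_besselOp {s : ℝ} (hs : 0 ≤ s) (u : L2Space d) :
    (𝓕 (besselOp d s hs u) : L2Space d) =ᵐ[volume]
      fun ξ => ((bracketSq ξ ^ (-s) : ℝ) : ℂ) * (𝓕 u : L2Space d) ξ :=
  fourier_fourierMul _ _

theorem besselOp_rieszOp_comm {s : ℝ} (hs : 0 ≤ s) (j : Fin d) (u : L2Space d) :
    besselOp d s hs (rieszOp j u) = rieszOp j (besselOp d s hs u) := by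
  refine ext_fourier ?_
  filter_upwards [fourier_besselOp hs (rieszOp j u), fourier_rieszOp j u,
    fourier_rieszOp j (besselOp d s hs u), fourier_besselOp hs u] with ξ h1 h2 h3 h4
  rw [h1, h2, h3, h4]
  ring

/-- The operator `(1 - Δ/4π²)⁻¹`. -/
def resolventOp (d : ℕ) : L2Space d →L[ℂ] L2Space d := besselOp d 1 zero_le_one

/-- The operator `∂ⱼ (1 - Δ/4π²)⁻¹`. -/
def gradOp (j : Fin d) : L2Space d →L[ℂ] L2Space d :=
  besselOp d (1 / 2) (by norm_num) ∘L rieszOp j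

/-- The operator `Δ (1 - Δ/4π²)⁻¹`. -/
def laplaceOp (d : ℕ) : L2Space d →L[ℂ] L2Space d := ∑ j, rieszOp j ∘L rieszOp j

theorem isWeakDeriv_resolventOp (j : Fin d) (u : L2Space d) :
    IsWeakDeriv j (resolventOp d u) (gradOp j u) := by
  rw [isWeakDeriv_iff_fourier]
  filter_upwards [fourier_besselOp zero_le_one u, fourier_rieszOp j u,
    fourier_besselOp (by norm_num : (0 : ℝ) ≤ 1 / 2) (rieszOp j u)] with ξ h1 h2 h3
  rw [resolventOp, gradOp, ContinuousLinearMap.comp_apply, h1, h3, h2, rieszSymbol]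
  have e : (-1 : ℝ) = -(1 / 2) + -(1 / 2) := by norm_num
  rw [e, Real.rpow_add (bracketSq_pos ξ)]
  push_cast
  ring

theorem isWeakDeriv_gradOp (j : Fin d) (u : L2Space d) :
    IsWeakDeriv j (gradOp j u) (rieszOp j (rieszOp j u)) := by
  rw [isWeakDeriv_iff_fourier]
  filter_upwards [fourier_rieszOp j (rieszOp j u), fourier_rieszOp j u,
    fourier_besselOp (by norm_num : (0 : ℝ) ≤ 1 / 2) (rieszOp j u)] with ξ h1 h2 h3
  rw [gradOp, ContinuousLinearMap.comp_apply, h1, h3, rieszSymbol]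
  ring

/-- Interpolation of `H¹` between `L²` and `H²`, pointwise on the Fourier side: `⟨ξ⟩⁻¹ ≤ δ + δ⁻¹
⟨ξ⟩⁻²`. -/
theorem norm_besselOp_half_le {δ : ℝ} (hδ : 0 < δ) (u : L2Space d) :
    ‖besselOp d (1 / 2) (by norm_num) u‖ ≤ δ * ‖u‖ + δ⁻¹ * ‖resolventOp d u‖ := by
  have h : ‖besselOp d (1 / 2) (by norm_num) u‖ ≤
      1 * ‖(δ : ℂ) • u + ((δ⁻¹ : ℝ) : ℂ) • resolventOp d u‖ := by
    refine norm_le_of_fourier_le ?_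
    have e : (𝓕 ((δ : ℂ) • u + ((δ⁻¹ : ℝ) : ℂ) • resolventOp d u) : L2Space d) =
        (δ : ℂ) • (𝓕 u : L2Space d) + ((δ⁻¹ : ℝ) : ℂ) • (𝓕 (resolventOp d u) : L2Space d) := by
      rw [FourierTransform.fourier_add, FourierTransform.fourier_smul,
        FourierTransform.fourier_smul]
    rw [e]
    filter_upwards [norm_fourier_besselOp (d := d) (s := 1 / 2) (by norm_num) u,
      fourier_besselOp zero_le_one u,
      Lp.coeFn_add ((δ : ℂ) • (𝓕 u : L2Space d))
        (((δ⁻¹ : ℝ) : ℂ) • (𝓕 (resolventOp d u) : L2Space d)),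
      Lp.coeFn_smul (δ : ℂ) (𝓕 u : L2Space d),
      Lp.coeFn_smul ((δ⁻¹ : ℝ) : ℂ) (𝓕 (resolventOp d u) : L2Space d)] with ξ h1 h2 h3 h4 h5
    have hp := bracketSq_pos ξ
    rw [h1, h3, Pi.add_apply, h4, h5, Pi.smul_apply, Pi.smul_apply, resolventOp, h2, smul_eq_mul,
      smul_eq_mul, ← mul_assoc, ← add_mul, norm_mul, ← Complex.ofReal_mul, ← Complex.ofReal_add,
      Complex.norm_real, Real.norm_of_nonneg (by positivity), one_mul]
    gcongr
    have e2 : bracketSq ξ ^ (-1 : ℝ) = (bracketSq ξ ^ (-(1 / 2) : ℝ)) ^ 2 := by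
      rw [← Real.rpow_mul_natCast hp.le]; norm_num
    rw [e2]
    set y := bracketSq ξ ^ (-(1 / 2) : ℝ)
    have h6 : y * δ ≤ δ ^ 2 + y ^ 2 := by nlinarith [sq_nonneg (y - δ), sq_nonneg y, sq_nonneg δ]
    have h7 : δ + δ⁻¹ * y ^ 2 = (δ ^ 2 + y ^ 2) / δ := by field_simp
    rw [h7, le_div_iff₀ hδ]
    exact h6
  rw [one_mul] at h
  refine h.trans ((norm_add_le _ _).trans_eq ?_)
  rw [norm_smul, norm_smul, Complex.norm_real, Complex.norm_real, Real.norm_of_nonneg hδ.le,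
    Real.norm_of_nonneg (inv_pos.2 hδ).le]

theorem sum_rieszSymbol_sq (ξ : EuclideanSpace ℝ (Fin d)) :
    ∑ j, rieszSymbol j ξ ^ 2 = ((-(4 * Real.pi ^ 2) * ‖ξ‖ ^ 2 / bracketSq ξ : ℝ) : ℂ) := by
  have hp := bracketSq_pos ξ
  have h1 : ∀ j, rieszSymbol j ξ ^ 2 =
      ((-(4 * Real.pi ^ 2) / bracketSq ξ * (ξ j) ^ 2 : ℝ) : ℂ) := fun j => by
    have e2 : (bracketSq ξ)⁻¹ = (bracketSq ξ ^ (-(1 / 2) : ℝ)) ^ 2 := by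
      rw [← Real.rpow_mul_natCast hp.le, ← Real.rpow_neg_one]; norm_num
    rw [rieszSymbol, derivSymbol, div_eq_mul_inv _ (bracketSq ξ), e2]
    push_cast
    linear_combination (4 * (Real.pi : ℂ) ^ 2 * (ξ j : ℂ) ^ 2 *
      ((bracketSq ξ ^ (-(1 / 2) : ℝ) : ℝ) : ℂ) ^ 2) * Complex.I_sq
  rw [Finset.sum_congr rfl fun j _ => h1 j, ← Complex.ofReal_sum, ← Finset.mul_sum,
    EuclideanSpace.real_norm_sq_eq]
  congr 1
  ring

theorem fourier_laplaceOp (u : L2Space d) : (𝓕 (laplaceOp d u) : L2Space d) =ᵐ[volume]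
    fun ξ => ((-(4 * Real.pi ^ 2) * ‖ξ‖ ^ 2 / bracketSq ξ : ℝ) : ℂ) * (𝓕 u : L2Space d) ξ := by
  have e : (𝓕 (laplaceOp d u) : L2Space d) =
      ∑ j, (𝓕 (rieszOp j (rieszOp j u)) : L2Space d) := by
    have := map_sum (Lp.fourierTransformₗᵢ (EuclideanSpace ℝ (Fin d)) ℂ)
      (fun j => rieszOp j (rieszOp j u)) Finset.univ
    rw [laplaceOp, sum_apply]
    exact this
  rw [e]
  have hs : ∀ s : Finset (Fin d), (∑ j ∈ s, (𝓕 (rieszOp j (rieszOp j u)) : L2Space d) : L2Space d)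
      =ᵐ[volume] fun ξ => (∑ j ∈ s, rieszSymbol j ξ ^ 2) * (𝓕 u : L2Space d) ξ := by
    intro s
    induction s using Finset.induction_on with
    | empty =>
      simp only [Finset.sum_empty, zero_mul]
      exact Lp.coeFn_zero ℂ 2 volume
    | insert j s hj ih =>
      rw [Finset.sum_insert hj]
      filter_upwards [ih, Lp.coeFn_add (𝓕 (rieszOp j (rieszOp j u)) : L2Space d)
        (∑ j ∈ s, (𝓕 (rieszOp j (rieszOp j u)) : L2Space d)), fourier_rieszOp j (rieszOp j u),
        fourier_rieszOp j u] with ξ h1 h2 h3 h4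
      rw [h2, Pi.add_apply, h1, h3, h4, Finset.sum_insert hj]
      ring
  filter_upwards [hs Finset.univ] with ξ h
  rw [h, sum_rieszSymbol_sq]

/-- This is `u = (1 - Δ/4π²) v` with `v = resolventOp d u`: the `H²` norm is controlled by `v` and
`Δ v`. -/
theorem norm_le_resolventOp_add_laplaceOp (u : L2Space d) :
    ‖u‖ ≤ ‖resolventOp d u‖ + (4 * Real.pi ^ 2)⁻¹ * ‖laplaceOp d u‖ := by
  have hpi : (0 : ℝ) < 4 * Real.pi ^ 2 := by positivity
  have h : u = resolventOp d u - (((4 * Real.pi ^ 2)⁻¹ : ℝ) : ℂ) • laplaceOp d u := by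
    refine ext_fourier ?_
    rw [fourier_sub, FourierTransform.fourier_smul]
    filter_upwards [fourier_laplaceOp u, fourier_besselOp zero_le_one u,
      Lp.coeFn_sub (𝓕 (resolventOp d u) : L2Space d)
        ((((4 * Real.pi ^ 2)⁻¹ : ℝ) : ℂ) • (𝓕 (laplaceOp d u) : L2Space d)),
      Lp.coeFn_smul (((4 * Real.pi ^ 2)⁻¹ : ℝ) : ℂ) (𝓕 (laplaceOp d u) : L2Space d)]
      with ξ h1 h2 h3 h4
    have hp := bracketSq_pos ξ
    rw [h3, Pi.sub_apply, h4, Pi.smul_apply, h1, resolventOp, h2, smul_eq_mul, ← mul_assoc,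
      ← sub_mul, ← Complex.ofReal_mul, ← Complex.ofReal_sub]
    have e : bracketSq ξ ^ (-1 : ℝ) -
        (4 * Real.pi ^ 2)⁻¹ * (-(4 * Real.pi ^ 2) * ‖ξ‖ ^ 2 / bracketSq ξ) = 1 := by
      rw [Real.rpow_neg_one]
      field_simp
      simp [bracketSq]
    rw [e, Complex.ofReal_one, one_mul]
  calc ‖u‖ = ‖resolventOp d u - (((4 * Real.pi ^ 2)⁻¹ : ℝ) : ℂ) • laplaceOp d u‖ := by rw [← h]
    _ ≤ _ := (norm_sub_le _ _).trans_eq (by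
      rw [norm_smul, Complex.norm_real, Real.norm_of_nonneg (inv_pos.2 hpi).le])

/-- The range of `(1 - Δ/4π²)⁻¹` is `H²`. -/
theorem mem_sobolevSpace_two_iff {v : L2Space d} :
    v ∈ sobolevSpace d 2 ↔ ∃ u, resolventOp d u = v := by
  rw [mem_sobolevSpace_iff]
  have hb : ∀ ξ : EuclideanSpace ℝ (Fin d), (1 + ‖ξ‖ ^ 2) ^ ((2 : ℝ) / 2) = bracketSq ξ := by
    simp [bracketSq]
  simp only [hb]
  constructor
  · rintro ⟨w, hw⟩
    refine ⟨𝓕⁻ w, ext_fourier ?_⟩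
    have h := fourier_besselOp zero_le_one (𝓕⁻ w : L2Space d)
    rw [fourier_fourierInv_eq] at h
    filter_upwards [h, hw] with ξ h1 h2
    rw [resolventOp, h1, h2, ← mul_assoc, ← Complex.ofReal_mul, Real.rpow_neg_one,
      inv_mul_cancel₀ (bracketSq_pos ξ).ne', Complex.ofReal_one, one_mul]
  · rintro ⟨u, rfl⟩
    refine ⟨𝓕 u, ?_⟩
    filter_upwards [fourier_besselOp zero_le_one u] with ξ h1
    rw [resolventOp, h1, ← mul_assoc, ← Complex.ofReal_mul, Real.rpow_neg_one,
      mul_inv_cancel₀ (bracketSq_pos ξ).ne', Complex.ofReal_one, one_mul]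

/-- The inverse has symbol `⟨ξ⟩² / D`. It is bounded because `|Im D| = |μ|` controls the `1` in
`⟨ξ⟩²` and `|Re D| = 4π² c₀ |ξ|²` controls the rest. -/
theorem surjective_const_laplaceOp_sub {c₀ μ : ℝ} (hc₀ : 0 < c₀) (hμ : μ ≠ 0) :
    Function.Surjective
      ((c₀ : ℂ) • laplaceOp d - ((μ : ℂ) * Complex.I) • resolventOp d) := by
  intro f
  let D : EuclideanSpace ℝ (Fin d) → ℂ := fun ξ =>
    ((-(4 * Real.pi ^ 2 * c₀) * ‖ξ‖ ^ 2 : ℝ) : ℂ) - (μ : ℂ) * Complex.I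
  have hre : ∀ ξ, (D ξ).re = -(4 * Real.pi ^ 2 * c₀) * ‖ξ‖ ^ 2 := fun ξ => by
    simp only [D, Complex.sub_re, Complex.ofReal_re, Complex.re_ofReal_mul, Complex.I_re,
      mul_zero, sub_zero]
  have him : ∀ ξ, (D ξ).im = -μ := fun ξ => by
    simp only [D, Complex.sub_im, Complex.ofReal_im, Complex.im_ofReal_mul, Complex.I_im,
      mul_one, zero_sub]
  have hD0 : ∀ ξ, D ξ ≠ 0 := fun ξ h => hμ (by
    have := him ξ
    rw [h, Complex.zero_im] at this
    linarith)
  have ha : (0 : ℝ) < 4 * Real.pi ^ 2 * c₀ := by positivity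
  have hm : MemLp (fun ξ => ((bracketSq (d := d) ξ : ℝ) : ℂ) / D ξ) ∞ volume := by
    refine memLp_top_of_continuous_of_bound ?_ (C := |μ|⁻¹ + (4 * Real.pi ^ 2 * c₀)⁻¹) fun ξ => ?_
    · refine (Complex.continuous_ofReal.comp continuous_bracketSq).div ?_ hD0
      simp only [D]
      fun_prop
    · rw [norm_div, Complex.norm_real, Real.norm_of_nonneg (bracketSq_pos ξ).le,
        div_le_iff₀ (norm_pos_iff.2 (hD0 ξ)), add_mul]
      have h1 := Complex.abs_im_le_norm (D ξ)
      have h2 := Complex.abs_re_le_norm (D ξ)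
      rw [him, abs_neg] at h1
      rw [hre, abs_mul, abs_neg, abs_of_pos ha, abs_of_nonneg (by positivity)] at h2
      rw [bracketSq]
      refine add_le_add ?_ ?_
      · rw [inv_mul_eq_div, le_div_iff₀ (abs_pos.2 hμ), one_mul]
        exact h1
      · rw [inv_mul_eq_div, le_div_iff₀ ha, mul_comm]
        exact h2
  refine ⟨fourierMul _ hm f, ext_fourier ?_⟩
  set u := fourierMul _ hm f
  have e : (𝓕 (((c₀ : ℂ) • laplaceOp d - ((μ : ℂ) * Complex.I) • resolventOp d) u) : L2Space d) =
      (c₀ : ℂ) • (𝓕 (laplaceOp d u) : L2Space d) -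
        ((μ : ℂ) * Complex.I) • (𝓕 (resolventOp d u) : L2Space d) := by
    rw [sub_apply, fourier_sub, smul_apply, smul_apply, FourierTransform.fourier_smul,
      FourierTransform.fourier_smul]
  rw [e]
  filter_upwards [fourier_laplaceOp u, fourier_besselOp zero_le_one u, fourier_fourierMul hm f,
    Lp.coeFn_sub ((c₀ : ℂ) • (𝓕 (laplaceOp d u) : L2Space d))
      (((μ : ℂ) * Complex.I) • (𝓕 (resolventOp d u) : L2Space d)),
    Lp.coeFn_smul (c₀ : ℂ) (𝓕 (laplaceOp d u) : L2Space d),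
    Lp.coeFn_smul ((μ : ℂ) * Complex.I) (𝓕 (resolventOp d u) : L2Space d)] with ξ h1 h2 h3 h4 h5 h6
  rw [h4, Pi.sub_apply, h5, h6, Pi.smul_apply, Pi.smul_apply, h1, resolventOp, h2, h3,
    Real.rpow_neg_one]
  have hb : ((bracketSq ξ : ℝ) : ℂ) ≠ 0 := Complex.ofReal_ne_zero.2 (bracketSq_pos ξ).ne'
  have hD := hD0 ξ
  have e2 : (c₀ : ℂ) * ((-(4 * Real.pi ^ 2) * ‖ξ‖ ^ 2 / bracketSq ξ : ℝ) : ℂ) -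
      (μ : ℂ) * Complex.I * (((bracketSq ξ)⁻¹ : ℝ) : ℂ) = D ξ / (bracketSq ξ : ℂ) := by
    simp only [D]
    push_cast
    field_simp
  simp only [smul_eq_mul]
  calc _ = ((c₀ : ℂ) * ((-(4 * Real.pi ^ 2) * ‖ξ‖ ^ 2 / bracketSq ξ : ℝ) : ℂ) -
      (μ : ℂ) * Complex.I * (((bracketSq ξ)⁻¹ : ℝ) : ℂ)) *
        (((bracketSq ξ : ℝ) : ℂ) / D ξ * (𝓕 f : L2Space d) ξ) := by ring
    _ = _ := by
      rw [e2]
      field_simp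

end Symbols

/-! ### Coefficients in `H^{r+1}` -/

section Coefficient

open FourierTransform
open scoped ComplexInnerProductSpace

variable {d : ℕ}

/-- Sobolev embedding, as `2 (r + 1) > d`. -/
theorem MemHs.memLp_top (hd : d ≤ 2) {r : ℝ} (hr : 0 < r) {c : EuclideanSpace ℝ (Fin d) → ℝ}
    (hc : MemHs (r + 1) c) : MemLp (fun x => (c x : ℂ)) ∞ volume := by
  have hd' : (d : ℝ) ≤ 2 := by exact_mod_cast hd
  obtain ⟨hf, hs⟩ := hc
  obtain ⟨u, hu⟩ := mem_sobolevSpace_iff.1 hs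
  obtain ⟨W, hW0, hW⟩ := exists_ae_norm_le (d := d) (s := r + 1) (by linarith)
  have h := hW (hf.toLp _) u 1 zero_le_one ?_
  · refine memLp_top_of_bound hf.1 (1 * (W * ‖u‖)) ?_
    filter_upwards [h, hf.coeFn_toLp] with x h1 h2
    rwa [h2] at h1
  · filter_upwards [hu] with ξ h1
    rw [h1, norm_mul, Complex.norm_real, Real.norm_of_nonneg (by positivity), one_mul, ← mul_assoc]
    have : bracketSq ξ ^ (-(r + 1) / 2) * (1 + ‖ξ‖ ^ 2) ^ ((r + 1) / 2) = 1 := by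
      rw [bracketSq, ← Real.rpow_add (by positivity)]
      ring_nf
      exact Real.rpow_zero _
    rw [this, one_mul]

/-- `∂ⱼ c = ⟨D⟩⁻ʳ (∂ⱼ ⟨D⟩⁻¹) ⟨D⟩^{r+1} c` lies in `Hʳ`; `U` is the weighted transform consumed by
`exists_productOp`. -/
theorem MemHs.exists_deriv {r : ℝ} (hr : 0 < r) {c : EuclideanSpace ℝ (Fin d) → ℝ}
    (hc : MemHs (r + 1) c) (hf : MemLp (fun x => (c x : ℂ)) 2 volume) (j : Fin d) :
    ∃ k U : L2Space d, IsWeakDeriv j (hf.toLp _) k ∧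
      ∀ᵐ ξ, ‖(𝓕 k : L2Space d) ξ‖ = bracketSq ξ ^ (-(r / 2)) * ‖U ξ‖ := by
  obtain ⟨hf', hs⟩ := hc
  obtain ⟨u, hu⟩ := mem_sobolevSpace_iff.1 hs
  set y : L2Space d := rieszOp j (𝓕⁻ u : L2Space d) with hy
  have hr2 : 0 ≤ r / 2 := by linarith
  refine ⟨besselOp d (r / 2) hr2 y, 𝓕 y, ?_, norm_fourier_besselOp hr2 y⟩
  rw [isWeakDeriv_iff_fourier]
  have h := fourier_rieszOp j (𝓕⁻ u : L2Space d)
  rw [fourier_fourierInv_eq] at h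
  filter_upwards [h, hu, fourier_besselOp hr2 y] with ξ h1 h2 h3
  rw [h3, hy, h1, h2, rieszSymbol]
  have e : bracketSq ξ ^ (-(r / 2)) * bracketSq ξ ^ (-(1 / 2) : ℝ) *
      (1 + ‖ξ‖ ^ 2) ^ ((r + 1) / 2) = 1 := by
    rw [bracketSq, ← Real.rpow_add (by positivity), ← Real.rpow_add (by positivity)]
    ring_nf
    exact Real.rpow_zero _
  calc _ = ((bracketSq ξ ^ (-(r / 2)) * bracketSq ξ ^ (-(1 / 2) : ℝ) *
      (1 + ‖ξ‖ ^ 2) ^ ((r + 1) / 2) : ℝ) : ℂ) *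
        (derivSymbol j ξ * (𝓕 (hf'.toLp _) : L2Space d) ξ) := by
        push_cast; ring
    _ = _ := by rw [e, Complex.ofReal_one, one_mul]

/-- The operator `div (c grad ·) (1 - Δ/4π²)⁻¹` for `c ∈ H^{r+1}`, `d ≤ 2`, differs from
`c Δ (1 - Δ/4π²)⁻¹` by an infinitesimally bounded perturbation. -/
theorem exists_divGradOp (hd : d ≤ 2) {r : ℝ} (hr₀ : 0 < r) (hr₁ : r < 1)
    {c : EuclideanSpace ℝ (Fin d) → ℝ} (hc : MemHs (r + 1) c)
    (hct : MemLp (fun x => (c x : ℂ)) ∞ volume) :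
    ∃ L : Fin d → L2Space d →L[ℂ] L2Space d,
      (∀ j u, IsWeakDeriv j (mulOp (fun x => (c x : ℂ)) hct (gradOp j u)) (L j u)) ∧
      ∀ δ > 0, ∃ C, 0 ≤ C ∧ ∀ u,
        ‖(∑ j, L j) u - mulOp (fun x => (c x : ℂ)) hct (laplaceOp d u)‖ ≤
          δ * ‖u‖ + C * ‖resolventOp d u‖ := by
  obtain ⟨hf, -⟩ := id hc
  choose k U hk hU using hc.exists_deriv hr₀ hf
  choose Q hQ hQb using fun j => exists_productOp hd hr₀ hr₁ (hU j)
  refine ⟨fun j => mulOp (fun x => (c x : ℂ)) hct ∘L rieszOp j ∘L rieszOp j + Q j ∘L rieszOp j,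
    fun j u => ?_, fun δ hδ => ?_⟩
  · exact (hk j).mul hct hf (isWeakDeriv_gradOp j u) (hQ j (rieszOp j u))
  · have hpi := Real.pi_pos
    -- `η` pays for the product estimates and `η'` for the interpolation of the `H¹` term, each at
    -- most `δ/2`. The factor `2π` bounds `rieszOp`, and the `+ 1` keeps denominators nonzero.
    have hη : 0 < δ / ((d + 1) * (2 * Real.pi) * 2) := by positivity
    choose C hC0 hC using fun j => hQb j (δ / ((d + 1) * (2 * Real.pi) * 2)) hη
    have hCs : 0 ≤ ∑ j, C j := Finset.sum_nonneg fun j _ => hC0 j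
    have hη' : 0 < δ / (((∑ j, C j) + 1) * (2 * Real.pi) * 2) := by positivity
    set η := δ / ((d + 1) * (2 * Real.pi) * 2) with hη_def
    set η' := δ / (((∑ j, C j) + 1) * (2 * Real.pi) * 2) with hη'_def
    refine ⟨(∑ j, C j) * (2 * Real.pi * η'⁻¹), by positivity, fun u => ?_⟩
    have e : (∑ j, (mulOp (fun x => (c x : ℂ)) hct ∘L rieszOp j ∘L rieszOp j +
        Q j ∘L rieszOp j)) u - mulOp (fun x => (c x : ℂ)) hct (laplaceOp d u) =
        ∑ j, Q j (rieszOp j u) := by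
      simp [laplaceOp, sum_apply, Finset.sum_add_distrib]
    rw [e]
    have hj : ∀ j, ‖Q j (rieszOp j u)‖ ≤ η * (2 * Real.pi * ‖u‖) +
        C j * (2 * Real.pi * (η' * ‖u‖ + η'⁻¹ * ‖resolventOp d u‖)) := fun j => by
      refine (hC j (rieszOp j u)).trans ?_
      -- With `rieszOp` outside, `⟨D⟩⁻¹ u` can be interpolated between `u` and `resolventOp d u`.
      rw [besselOp_rieszOp_comm]
      gcongr
      · exact norm_rieszOp_le j u
      · exact hC0 j
      · refine (norm_rieszOp_le j _).trans ?_
        gcongr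
        exact norm_besselOp_half_le hη' u
    refine (norm_sum_le_of_le _ fun j _ => hj j).trans ?_
    rw [Finset.sum_add_distrib, Finset.sum_const, Finset.card_univ, Fintype.card_fin,
      nsmul_eq_mul, ← Finset.sum_mul]
    have h1 : d * (η * (2 * Real.pi)) ≤ δ / 2 := by
      rw [hη_def]
      have : (d : ℝ) * (δ / ((d + 1) * (2 * Real.pi) * 2) * (2 * Real.pi)) =
          d / (d + 1) * (δ / 2) := by field_simp
      rw [this]
      have h : (d : ℝ) / (d + 1) ≤ 1 := div_le_one_of_le₀ (by linarith) (by positivity)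
      nlinarith
    have h2 : (∑ j, C j) * (2 * Real.pi * η') ≤ δ / 2 := by
      rw [hη'_def]
      have : (∑ j, C j) * (2 * Real.pi * (δ / (((∑ j, C j) + 1) * (2 * Real.pi) * 2))) =
          (∑ j, C j) / ((∑ j, C j) + 1) * (δ / 2) := by field_simp
      rw [this]
      have h : (∑ j, C j) / ((∑ j, C j) + 1) ≤ 1 := div_le_one_of_le₀ (by linarith) (by positivity)
      nlinarith
    calc _ = (d * (η * (2 * Real.pi)) + (∑ j, C j) * (2 * Real.pi * η')) * ‖u‖ +
          (∑ j, C j) * (2 * Real.pi * η'⁻¹) * ‖resolventOp d u‖ := by ring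
      _ ≤ _ := by
        gcongr
        linarith

/-! ### Symmetry and surjectivity for divergence form operators. -/

/-- Symmetry of an operator in divergence form. -/
theorem inner_im_eq_zero_of_isWeakDeriv {c : EuclideanSpace ℝ (Fin d) → ℝ}
    {hct : MemLp (fun x => (c x : ℂ)) ∞ volume} {v : L2Space d} {g w : Fin d → L2Space d}
    (hg : ∀ j, IsWeakDeriv j v (g j))
    (hw : ∀ j, IsWeakDeriv j (mulOp (fun x => (c x : ℂ)) hct (g j)) (w j)) :
    (⟪v, ∑ j, w j⟫).im = 0 := by
  rw [inner_sum, Complex.im_sum]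
  refine Finset.sum_eq_zero fun j _ => ?_
  rw [(hg j).inner_eq (hw j), Complex.neg_im, neg_eq_zero]
  have h := inner_mulOp_ofReal hct (g j) (g j)
  rw [← inner_conj_symm] at h
  exact Complex.conj_eq_iff_im.1 h

/-- Integration by parts brings both sides to `-∑ⱼ ⟪gⱼ, c g'ⱼ⟫`, as `c` is real. -/
theorem inner_divGrad_symm {c : EuclideanSpace ℝ (Fin d) → ℝ}
    {hct : MemLp (fun x => (c x : ℂ)) ∞ volume} {v v' : L2Space d} {g w g' w' : Fin d → L2Space d}
    (hg : ∀ j, IsWeakDeriv j v (g j))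
    (hw : ∀ j, IsWeakDeriv j (mulOp (fun x => (c x : ℂ)) hct (g j)) (w j))
    (hg' : ∀ j, IsWeakDeriv j v' (g' j))
    (hw' : ∀ j, IsWeakDeriv j (mulOp (fun x => (c x : ℂ)) hct (g' j)) (w' j)) :
    ⟪∑ j, w j, v'⟫ = ⟪v, ∑ j, w' j⟫ := by
  rw [inner_sum, sum_inner]
  refine Finset.sum_congr rfl fun j _ => ?_
  have h1 := (hg j).inner_eq (hw' j)
  have h2 := (hw j).inner_eq (hg' j)
  rw [inner_mulOp_ofReal] at h2
  rw [h1, h2, neg_neg]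

theorem IsWeakDeriv.add {j : Fin d} {f h f' h' : L2Space d} (H : IsWeakDeriv j f h)
    (H' : IsWeakDeriv j f' h') : IsWeakDeriv j (f + f') (h + h') := by
  unfold IsWeakDeriv at *
  simp only [← Lp.toTemperedDistributionCLM_apply] at *
  rw [map_add, map_add, LineDeriv.lineDerivOp_add, H, H']

theorem IsWeakDeriv.smul {j : Fin d} {f h : L2Space d} (a : ℂ) (H : IsWeakDeriv j f h) :
    IsWeakDeriv j (a • f) (a • h) := by
  unfold IsWeakDeriv at *
  simp only [← Lp.toTemperedDistributionCLM_apply] at *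
  rw [map_smul, map_smul, LineDeriv.lineDerivOp_smul, H]

/-- The uniform a priori estimate and the method of continuity. -/
theorem surjective_divGradOp_sub {c₀ μ : ℝ} (hc₀ : 0 < c₀) (hμ : μ ≠ 0)
    {c : EuclideanSpace ℝ (Fin d) → ℝ} (hc : ∀ x, 0 ≤ c x)
    (hct : MemLp (fun x => (c x : ℂ)) ∞ volume) {L : L2Space d →L[ℂ] L2Space d}
    (hsymm : ∀ u, (⟪resolventOp d u, laplaceOp d u⟫).im = 0)
    (hsymm' : ∀ u, (⟪resolventOp d u, L u⟫).im = 0)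
    (hL : ∀ δ > 0, ∃ C, 0 ≤ C ∧ ∀ u,
        ‖L u - mulOp (fun x => (c x : ℂ)) hct (laplaceOp d u)‖ ≤
          δ * ‖u‖ + C * ‖resolventOp d u‖) (f : L2Space d) :
    ∃ u, (c₀ : ℂ) • laplaceOp d u + L u - ((μ : ℂ) * Complex.I) • resolventOp d u = f := by
  have hpi := Real.pi_pos
  set a : ℝ := 4 * Real.pi ^ 2 with ha_def
  have ha : 0 < a := by positivity
  have hμ' := abs_pos.2 hμ
  -- In `‖u‖ ≤ ‖v‖ + a⁻¹ ‖Δ v‖`, where `c₀ ‖Δ v‖` carries the error `δ ‖u‖`, this `δ` leaves exactly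
  -- `‖u‖ / 2` to absorb. `K` collects the coefficients of `‖y‖`.
  obtain ⟨C, hC0, hC⟩ := hL (a * c₀ / 2) (by positivity)
  set K : ℝ := |μ|⁻¹ + (a * c₀)⁻¹ * (2 + C * |μ|⁻¹) with hK_def
  have hK : 0 < K := by positivity
  have hb : ∀ t : ℝ, 0 ≤ t → t ≤ 1 → ∀ u, (2 * K)⁻¹ * ‖u‖ ≤
      ‖(((c₀ : ℂ) • laplaceOp d - ((μ : ℂ) * Complex.I) • resolventOp d) + t • L) u‖ := by
    intro t ht0 ht1 u
    set y := (((c₀ : ℂ) • laplaceOp d - ((μ : ℂ) * Complex.I) • resolventOp d) + t • L) u with hy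
    set w := (c₀ : ℂ) • laplaceOp d u + (t : ℂ) • L u with hw
    have hyw : y = w - ((μ : ℂ) * Complex.I) • resolventOp d u := by
      simp only [hy, hw, add_apply, sub_apply, smul_apply, Complex.coe_smul t]
      abel
    have him : (⟪resolventOp d u, w⟫).im = 0 := by
      rw [hw, inner_add_right, inner_smul_right, inner_smul_right, Complex.add_im,
        Complex.im_ofReal_mul, Complex.im_ofReal_mul, hsymm, hsymm']
      simp
    have h1 : |μ| * ‖resolventOp d u‖ ≤ ‖y‖ := by
      rw [hyw]
      exact abs_mul_norm_le_of_real_inner him μ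
    have h2 : ‖w‖ ≤ 2 * ‖y‖ := by
      have e : w = y + ((μ : ℂ) * Complex.I) • resolventOp d u := by rw [hyw]; abel
      rw [e]
      refine (norm_add_le _ _).trans ?_
      rw [norm_smul, norm_mul, Complex.norm_I, Complex.norm_real, mul_one, Real.norm_eq_abs]
      linarith
    -- Ellipticity, pointwise: `c₀ + t c₁ ≥ c₀`, so `Δ v` is controlled by `z = (c₀ + t c₁) Δ v`,
    -- which differs from `w` by the small perturbation.
    have h3 : c₀ * ‖laplaceOp d u‖ ≤ ‖w‖ + (a * c₀ / 2 * ‖u‖ + C * ‖resolventOp d u‖) := by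
      set z := (c₀ : ℂ) • laplaceOp d u +
        (t : ℂ) • mulOp (fun x => (c x : ℂ)) hct (laplaceOp d u) with hz
      have e1 : ‖laplaceOp d u‖ ≤ c₀⁻¹ * ‖z‖ := by
        refine norm_le_of_ae_le ?_
        filter_upwards [coeFn_mulOp hct (laplaceOp d u), Lp.coeFn_add ((c₀ : ℂ) • laplaceOp d u)
          ((t : ℂ) • mulOp (fun x => (c x : ℂ)) hct (laplaceOp d u)),
          Lp.coeFn_smul (c₀ : ℂ) (laplaceOp d u),
          Lp.coeFn_smul (t : ℂ) (mulOp (fun x => (c x : ℂ)) hct (laplaceOp d u))]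
          with x a1 a2 a3 a4
        have hx := mul_nonneg ht0 (hc x)
        rw [hz, a2, Pi.add_apply, a3, a4, Pi.smul_apply, Pi.smul_apply, a1, smul_eq_mul,
          smul_eq_mul, ← mul_assoc, ← add_mul, norm_mul, ← Complex.ofReal_mul,
          ← Complex.ofReal_add, Complex.norm_real, Real.norm_of_nonneg (by positivity),
          ← mul_assoc]
        refine le_mul_of_one_le_left (norm_nonneg _) ?_
        rw [inv_mul_eq_div, le_div_iff₀ hc₀]
        linarith
      rw [le_inv_mul_iff₀ hc₀] at e1
      have e2 : z = w - (t : ℂ) • (L u - mulOp (fun x => (c x : ℂ)) hct (laplaceOp d u)) := by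
        rw [hz, hw, smul_sub]; abel
      refine e1.trans ?_
      rw [e2]
      refine (norm_sub_le _ _).trans (add_le_add le_rfl ?_)
      rw [norm_smul, Complex.norm_real, Real.norm_of_nonneg ht0]
      exact (mul_le_of_le_one_left (norm_nonneg _) ht1).trans (hC u)
    have h4 := norm_le_resolventOp_add_laplaceOp u
    have h1' : ‖resolventOp d u‖ ≤ |μ|⁻¹ * ‖y‖ := by rwa [le_inv_mul_iff₀ hμ']
    have h5 : ‖laplaceOp d u‖ ≤ c₀⁻¹ * (2 * ‖y‖ + (a * c₀ / 2 * ‖u‖ + C * (|μ|⁻¹ * ‖y‖))) := by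
      rw [le_inv_mul_iff₀ hc₀]
      refine h3.trans ?_
      gcongr
    have h6 : ‖u‖ ≤ K * ‖y‖ + ‖u‖ / 2 := by
      calc ‖u‖ ≤ |μ|⁻¹ * ‖y‖ +
            a⁻¹ * (c₀⁻¹ * (2 * ‖y‖ + (a * c₀ / 2 * ‖u‖ + C * (|μ|⁻¹ * ‖y‖)))) := by
            refine h4.trans ?_
            gcongr
        _ = K * ‖y‖ + ‖u‖ / 2 := by
            rw [hK_def]
            field_simp
            ring
    rw [inv_mul_le_iff₀ (by positivity)]
    linarith
  have hsurj := surjective_of_continuity (by positivity) hb (surjective_const_laplaceOp_sub hc₀ hμ)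
  obtain ⟨u, hu⟩ := hsurj f
  refine ⟨u, ?_⟩
  rw [← hu]
  simp only [add_apply, sub_apply, smul_apply]
  abel

/-- Componentwise weak derivatives of `c gⱼ` give the weak divergence of `c g`. -/
theorem isWeakDiv_of_isWeakDeriv {c : C(EuclideanSpace ℝ (Fin d), ℝ)} {g p w : Fin d → L2Space d}
    (hp : ∀ j, p j =ᵐ[volume] fun x => (c x : ℂ) * g j x) (hw : ∀ j, IsWeakDeriv j (p j) (w j)) :
    IsWeakDiv c g (∑ j, w j) := by
  intro φ hφ hs
  let ψ : 𝓢(EuclideanSpace ℝ (Fin d), ℂ) := hs.toSchwartzMap hφ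
  have h1 : ∀ j, ∫ x, (c x : ℂ) * g j x * fderiv ℝ φ x (EuclideanSpace.single j 1) =
      -((w j : 𝓢'(EuclideanSpace ℝ (Fin d), ℂ)) ψ) := fun j => by
    have h2 := isWeakDeriv_iff_integral.1 (hw j) ψ
    rw [Lp.toTemperedDistribution_apply]
    simp only [smul_eq_mul, mul_comm (ψ _)]
    rw [← h2]
    refine integral_congr_ae ?_
    filter_upwards [hp j] with x hx
    rw [hx]
    rfl
  rw [Finset.sum_congr rfl fun j _ => h1 j, Finset.sum_neg_distrib, neg_inj]
  have h3 := congrArg (fun T : 𝓢'(EuclideanSpace ℝ (Fin d), ℂ) => T ψ)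
    (map_sum (Lp.toTemperedDistributionCLM ℂ
      (volume : Measure (EuclideanSpace ℝ (Fin d))) 2) w Finset.univ)
  simp only [Lp.toTemperedDistributionCLM_apply, sum_apply, Lp.toTemperedDistribution_apply,
    smul_eq_mul] at h3
  simp only [Lp.toTemperedDistribution_apply, smul_eq_mul]
  rw [← h3]
  refine integral_congr_ae (Eventually.of_forall fun x => ?_)
  exact mul_comm _ _

end Coefficient

end

/-! ### The main theorem. -/

theorem mainTheorem2 (d : ℕ) (hd₁ : 1 ≤ d) (hd₂ : d ≤ 2) (r : ℝ) (hr₀ : 0 < r) (hr₁ : r < 1)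
    (c : C(EuclideanSpace ℝ (Fin d), ℝ)) (c₀ : ℝ) (c₁ : EuclideanSpace ℝ (Fin d) → ℝ)
    (hc : ∀ x, c x = c₀ + c₁ x) (hc₀ : 0 < c₀) (hc₁ : ∀ x, 0 ≤ c₁ x) (hc₁' : MemHs (r + 1) c₁) :
    (divGrad c).domain = sobolevSpace d 2 ∧
    IsSelfAdjoint (divGrad c) ∧
    (∃ T : ℝ → (L2Space d ≃ₗᵢ[ℂ] L2Space d),
      IsUnitaryGroup T ∧ IsGenerator (Complex.I • divGrad c) T) ∧
    ∀ μ : ℝ, μ ≠ 0 → ∃ R : L2Space d →L[ℂ] L2Space d,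
      IsResolvent (Complex.I • divGrad c) (μ : ℂ) R ∧ ∀ v : L2Space d, ‖R v‖ ≤ ‖v‖ / |μ| := by
  have hct := hc₁'.memLp_top hd₂ hr₀
  obtain ⟨L, hL, hLb⟩ := exists_divGradOp hd₂ hr₀ hr₁ hc₁' hct
  -- The coefficient `1` lets the symmetry lemmas for divergence form operators apply to the
  -- Laplacian too.
  have hone : MemLp (fun _ : EuclideanSpace ℝ (Fin d) => ((1 : ℝ) : ℂ)) ∞ volume :=
    memLp_top_of_continuous_of_bound continuous_const (C := 1) fun x => by simp
  have hmul_one : ∀ f : L2Space d, mulOp (fun _ => ((1 : ℝ) : ℂ)) hone f = f := fun f => by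
    refine Lp.ext ?_
    filter_upwards [coeFn_mulOp hone f] with x hx
    rw [hx, Complex.ofReal_one, one_mul]
  have hlap : ∀ u : L2Space d, laplaceOp d u = ∑ j, rieszOp j (rieszOp j u) := fun u => by
    rw [laplaceOp, sum_apply]
    rfl
  -- Since `resolventOp d` has range `H²`, this formula gives both the full domain and the values of
  -- `A`.
  have hdiv : ∀ u, IsDivGrad c (resolventOp d u)
      ((c₀ : ℂ) • laplaceOp d u + (∑ j, L j) u) := fun u => by
    refine ⟨mem_sobolevSpace_two_iff.2 ⟨u, rfl⟩, fun j => gradOp j u,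
      fun j => isWeakDeriv_resolventOp j u, ?_⟩
    have e : (c₀ : ℂ) • laplaceOp d u + (∑ j, L j) u =
        ∑ j, ((c₀ : ℂ) • rieszOp j (rieszOp j u) + L j u) := by
      rw [hlap, Finset.smul_sum, sum_apply, Finset.sum_add_distrib]
    rw [e]
    refine isWeakDiv_of_isWeakDeriv
      (p := fun j => (c₀ : ℂ) • gradOp j u + mulOp (fun x => (c₁ x : ℂ)) hct (gradOp j u))
      (fun j => ?_) fun j => ((isWeakDeriv_gradOp j u).smul _).add (hL j u)
    filter_upwards [Lp.coeFn_add ((c₀ : ℂ) • gradOp j u)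
      (mulOp (fun x => (c₁ x : ℂ)) hct (gradOp j u)), Lp.coeFn_smul (c₀ : ℂ) (gradOp j u),
      coeFn_mulOp hct (gradOp j u)] with x h1 h2 h3
    rw [h1, Pi.add_apply, h2, h3, Pi.smul_apply, hc, smul_eq_mul, Complex.ofReal_add]
    ring
  have hdom : (divGrad c).domain = sobolevSpace d 2 := by
    ext v
    refine ⟨fun ⟨w, hw⟩ => hw.1, fun hv => ?_⟩
    obtain ⟨u, rfl⟩ := mem_sobolevSpace_two_iff.1 hv
    exact ⟨_, hdiv u⟩
  have hval : ∀ (u : L2Space d) (h : resolventOp d u ∈ (divGrad c).domain),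
      divGrad c ⟨resolventOp d u, h⟩ = (c₀ : ℂ) • laplaceOp d u + (∑ j, L j) u := fun u h =>
    (isDivGrad_divGrad c ⟨resolventOp d u, h⟩).unique (hdiv u)
  have hgrad2 : ∀ (u : L2Space d) j,
      IsWeakDeriv j (mulOp (fun _ => ((1 : ℝ) : ℂ)) hone (gradOp j u)) (rieszOp j (rieszOp j u)) :=
    fun u j => by rw [hmul_one]; exact isWeakDeriv_gradOp j u
  have hA : IsSymmetricWithRange (divGrad c) := by
    constructor
    · rintro ⟨v, hv⟩ ⟨v', hv'⟩
      obtain ⟨u, rfl⟩ := mem_sobolevSpace_two_iff.1 (hdom ▸ hv)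
      obtain ⟨u', rfl⟩ := mem_sobolevSpace_two_iff.1 (hdom ▸ hv')
      rw [hval, hval, inner_add_left, inner_add_right, inner_smul_left, inner_smul_right,
        Complex.conj_ofReal, hlap, hlap, sum_apply, sum_apply]
      congr 1
      · congr 1
        exact inner_divGrad_symm (fun j => isWeakDeriv_resolventOp j u) (hgrad2 u)
          (fun j => isWeakDeriv_resolventOp j u') (hgrad2 u')
      · exact inner_divGrad_symm (fun j => isWeakDeriv_resolventOp j u) (fun j => hL j u)
          (fun j => isWeakDeriv_resolventOp j u') (fun j => hL j u')
    · intro μ hμ f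
      obtain ⟨u, hu⟩ := surjective_divGradOp_sub hc₀ hμ hc₁ hct
        (fun u => by
          rw [hlap]
          exact inner_im_eq_zero_of_isWeakDeriv (fun j => isWeakDeriv_resolventOp j u) (hgrad2 u))
        (fun u => by
          rw [sum_apply]
          exact inner_im_eq_zero_of_isWeakDeriv (fun j => isWeakDeriv_resolventOp j u)
            fun j => hL j u) hLb f
      have hmem : resolventOp d u ∈ (divGrad c).domain := ⟨_, hdiv u⟩
      exact ⟨⟨resolventOp d u, hmem⟩, by rw [hval]; exact hu⟩
  exact ⟨hdom, hA.isSelfAdjoint, hA.exists_unitaryGroup, fun μ hμ => hA.exists_resolvent_I_smul hμ⟩
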